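/- Let $X$ be a locally compact Hausdorff space and $n\ge 0$ an integer. A twisted $n$-sheeted covering $(Z,s,\mathcal L)$ of $X$ consists of a locally compact Hausdorff space $Z$, a surjective covering map $s\colon Z\to X$ all of whose fibres have exactly $n$ points, and a Hermitian line bundle $\mathcal L=(L,p_L,Z)$. An isomorphism $(Z,s,\mathcal L)\to(Z',s',\mathcal L')$ consists of a homeomorphism $\phi\colon Z\to Z'$ with $s'\circ\phi=s$ and an isomorphism of Hermitian line bundles (fibrewise isometric) $\mathcal L\cong\phi^*\mathcal L'$. Let $\Gamma_0(Z,s,\mathcal L)$ be the right Hilbert $C_0(X)$-module of continuous sections of $\mathcal L$ vanishing at infinity, with $$(\xi f)(z)=\xi(z)f(s(z)),\qquad \langle\xi,\eta\rangle(x)=\sum_{s(z)=x}\langle\xi(z),\eta(z)\rangle_{\mathcal L}.$$ Let $\mathcal U(N_{D_n})$ be the topological group of unitary $n\times n$ matrices $u$ with $u^*D_nu\subseteq D_n$ and $uD_nu^*\subseteq D_n$, where $D_n$ is the algebra of diagonal matrices; each such $u$ is $\lambda\sigma$ with $\lambda$ a unitary diagonal matrix and $\sigma$ the matrix of a permutation.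 It acts on $\mathbb C^n$ by matrix multiplication and on $\{1,\dots,n\}\times\mathbb C$ by $\lambda\sigma\cdot(k,c)=(\sigma(k),\lambda_{\sigma(k)}c)$. For a (locally trivial) principal $\mathcal U(N_{D_n})$-bundle $\mathcal P=(P,p,X)$ and a space $F$ on which $\mathcal U(N_{D_n})$ acts, $\mathcal P\times F$ denotes the associated bundle, i.e. the quotient of $P\times F$ by $(\alpha,t)\sim(\alpha g,g^{-1}t)$. The vector bundle $\mathcal P\times\mathbb C^n$ has the metric $\langle[\alpha,v],[\alpha,w]\rangle=\langle v,w\rangle$, and $\Gamma_0(\mathcal P\times\mathbb C^n)$ is the right Hilbert $C_0(X)$-module of its continuous sections vanishing at infinity. We say that $\mathcal P$ corresponds to $(Z,s,\mathcal L)$ via $\theta$ if $\theta$ is a homeomorphism from $\mathcal P\times(\{1,\dots,n\}\times\mathbb C)$ onto $L$ that preserves the projections to $X$ (on $L$ this is $s\circ p_L$) and such that for all $\alpha\in P$ and $k\in\{1,\dots,n\}$ the map $c\mapsto\theta[\alpha,(k,c)]$ is a linear isometry of $\mathbb C$ onto a fibre of $\mathcal L$. Then: 1. For every twisted $n$-sheeted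 covering of $X$ there is a principal $\mathcal U(N_{D_n})$-bundle over $X$ that corresponds to it. 2. One can choose, for every twisted $n$-sheeted covering $(Z,s,\mathcal L)$ of $X$ and every principal bundle $\mathcal P$ that corresponds to it via some $\theta$, an isomorphism of right Hilbert $C_0(X)$-modules $$\Phi_\theta\colon\Gamma_0(\mathcal P\times\mathbb C^n)\to\Gamma_0(Z,s,\mathcal L)$$ which is natural in the following sense. Let $e\colon(Z,s,\mathcal L)\to(Z',s',\mathcal L')$ be an isomorphism of twisted $n$-sheeted coverings, and let $\mathcal P$ and $\mathcal P'$ correspond to them via $\theta$ and $\theta'$. Then there is exactly one isomorphism of principal bundles $f\colon\mathcal P\to\mathcal P'$ that is induced by $e$, i.e. such that $\theta'[f(\alpha),t]=e(\theta[\alpha,t])$ for all $\alpha\in P$ and $t\in\{1,\dots,n\}\times\mathbb C$, and the isomorphisms of right Hilbert $C_0(X)$-modules $f_*\colon\Gamma_0(\mathcal P\times\mathbb C^n)\to\Gamma_0(\mathcal P'\times\mathbb C^n)$ and $e_*\colon\Gamma_0(Z,s,\mathcal L)\to\Gamma_0(Z',s',\mathcal L')$ induced by $f$ and $e$ satisfy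 $$e_*\circ\Phi_\theta=\Phi_{\theta'}\circ f_* .$$ -/

import Mathlib

open Bundle Topology Filter Function
open scoped ZeroAtInfty ComplexOrder RightActions

universe u v w p

noncomputable section

namespace TwistedCoverings

/-! ### The C⋆-algebra `C₀(X, ℂ)` and unitary isomorphisms of Hilbert modules -/

/-- The order of the C⋆-algebra `C₀(X, ℂ)`: `f ≤ g` iff `g - f` is pointwise nonnegative. -/
instance czeroPartialOrder (X : Type*) [TopologicalSpace X] : PartialOrder C₀(X, ℂ) :=
  PartialOrder.lift (fun f => (f : X → ℂ)) DFunLike.coe_injective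

/-- An isomorphism of right Hilbert modules over `A`: a bijective linear map that respects the
action of `A` and the `A`-valued inner products. -/
structure HilbertModuleIso (A E E' : Type*) [NonUnitalSemiring A] [StarRing A] [Module ℂ A]
    [PartialOrder A] [Norm A]
    [AddCommGroup E] [Module ℂ E] [SMul A E] [Norm E] [CStarModule A E]
    [AddCommGroup E'] [Module ℂ E'] [SMul A E'] [Norm E'] [CStarModule A E']
    extends E ≃ₗ[ℂ] E' where
  map_act : ∀ (a : A) (ξ : E), toFun (a • ξ) = a • toFun ξ
  inner_map : ∀ ξ η : E, inner A (toFun ξ) (toFun η) = inner A ξ η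

/-! ### Sections vanishing at infinity of a Hermitian vector bundle -/

section Sections

variable {B : Type*} [TopologicalSpace B] (F : Type*) [NormedAddCommGroup F] [NormedSpace ℂ F]
  (E : B → Type*) [TopologicalSpace (TotalSpace F E)]
  [∀ b, NormedAddCommGroup (E b)] [∀ b, InnerProductSpace ℂ (E b)]

/-- The fibrewise inner products of the bundle `E` form a metric: they are continuous on the total
space of `E ⊕ E`. -/
class IsHermitianBundle : Prop where
  continuous_inner : Continuous fun q : TotalSpace (F × F) (E ×ᵇ E) => inner ℂ q.2.1 q.2.2

variable [FiberBundle F E] [VectorBundle ℂ F E]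

variable {F E} in
theorem continuous_section_add {ξ η : ∀ b, E b}
    (hξ : Continuous fun b => TotalSpace.mk' F b (ξ b))
    (hη : Continuous fun b => TotalSpace.mk' F b (η b)) :
    Continuous fun b => TotalSpace.mk' F b (ξ b + η b) := by
  rw [continuous_iff_continuousAt] at *
  intro b
  have h1 := (FiberBundle.continuousAt_section (F := F) (E := E) (s := ξ) b).1 (hξ b)
  have h2 := (FiberBundle.continuousAt_section (F := F) (E := E) (s := η) b).1 (hη b)
  refine (FiberBundle.continuousAt_section (F := F) (E := E) (s := ξ + η) b).2
    ((h1.add h2).congr ?_)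
  filter_upwards [(trivializationAt F E b).open_baseSet.mem_nhds
    (FiberBundle.mem_baseSet_trivializationAt' b)] with c hc
  exact (((trivializationAt F E b).linear ℂ hc).map_add (ξ c) (η c)).symm

variable {F E} in
theorem continuous_section_smul {f : B → ℂ} (hf : Continuous f) {ξ : ∀ b, E b}
    (hξ : Continuous fun b => TotalSpace.mk' F b (ξ b)) :
    Continuous fun b => TotalSpace.mk' F b (f b • ξ b) := by
  rw [continuous_iff_continuousAt] at *
  intro b
  have h1 := (FiberBundle.continuousAt_section (F := F) (E := E) (s := ξ) b).1 (hξ b)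
  refine (FiberBundle.continuousAt_section (F := F) (E := E) (s := fun c => f c • ξ c) b).2
    (((hf b).smul h1).congr ?_)
  filter_upwards [(trivializationAt F E b).open_baseSet.mem_nhds
    (FiberBundle.mem_baseSet_trivializationAt' b)] with c hc
  exact (((trivializationAt F E b).linear ℂ hc).map_smul (f c) (ξ c)).symm

/-- The space `Γ₀(E)` of continuous sections of `E` that vanish at infinity. -/
def sectionSubmodule : Submodule ℂ (∀ b, E b) where
  carrier := {ξ | (Continuous fun b => TotalSpace.mk' F b (ξ b)) ∧
    Tendsto (fun b => ‖ξ b‖) (cocompact B) (𝓝 0)}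
  add_mem' := by
    rintro ξ η ⟨h1, h2⟩ ⟨h3, h4⟩
    refine ⟨continuous_section_add h1 h3, ?_⟩
    have := h2.add h4
    rw [add_zero] at this
    exact squeeze_zero (fun _ => norm_nonneg _) (fun b => norm_add_le _ _) this
  zero_mem' := by
    exact ⟨Trivialization.continuous_zeroSection ℂ, by simp [tendsto_const_nhds]⟩
  smul_mem' := by
    rintro c ξ ⟨h1, h2⟩
    refine ⟨continuous_section_smul continuous_const h1, ?_⟩
    have := h2.const_mul ‖c‖
    rw [mul_zero] at this
    simpa [norm_smul] using this

/-- The space `Γ₀(E)` as a type of its own; it carries the structure of a right Hilbert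
`C₀(B)`-module. -/
def C0Sections : Type _ := ↥(sectionSubmodule F E)

variable {F E}

instance : AddCommGroup (C0Sections F E) := inferInstanceAs (AddCommGroup (sectionSubmodule F E))

instance : Module ℂ (C0Sections F E) := inferInstanceAs (Module ℂ (sectionSubmodule F E))

instance : CoeFun (C0Sections F E) fun _ => ∀ b, E b := ⟨fun ξ => ξ.1⟩

@[ext]
theorem C0Sections.ext {ξ η : C0Sections F E} (h : ∀ b, ξ b = η b) : ξ = η :=
  Subtype.ext (funext h)

@[simp] theorem C0Sections.add_apply (ξ η : C0Sections F E) (b : B) : (ξ + η) b = ξ b + η b := rfl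
@[simp] theorem C0Sections.zero_apply (b : B) : (0 : C0Sections F E) b = 0 := rfl
@[simp] theorem C0Sections.smul_apply (c : ℂ) (ξ : C0Sections F E) (b : B) :
    (c • ξ) b = c • ξ b := rfl

/-- Multiplication of a section by a bounded continuous function. -/
def C0Sections.mulBounded (f : B → ℂ) (hf : Continuous f) (C : ℝ) (hC : ∀ b, ‖f b‖ ≤ C)
    (ξ : C0Sections F E) : C0Sections F E :=
  ⟨fun b => f b • ξ b, continuous_section_smul hf ξ.2.1, by
    have h := ξ.2.2.const_mul C
    rw [mul_zero] at h
    refine squeeze_zero (fun _ => norm_nonneg _) (fun b => ?_) h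
    rw [norm_smul]
    exact mul_le_mul_of_nonneg_right (hC b) (norm_nonneg _)⟩

theorem czero_norm_le {X : Type*} [TopologicalSpace X] (f : C₀(X, ℂ)) (x : X) : ‖f x‖ ≤ ‖f‖ :=
  f.toBCF.norm_coe_le_norm x

/-- The right action of `C₀(B)` on `Γ₀(E)`: `(ξ f)(b) = ξ(b) f(b)`. As `C₀(B)` is commutative, the
action is written on the left. -/
instance : SMul C₀(B, ℂ) (C0Sections F E) where
  smul f ξ := C0Sections.mulBounded f f.continuous ‖f‖ (czero_norm_le f) ξ

@[simp] theorem C0Sections.czero_smul_apply (f : C₀(B, ℂ)) (ξ : C0Sections F E) (b : B) :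
    (f • ξ) b = f b • ξ b := rfl

variable [IsHermitianBundle F E]

/-- The `C₀(B)`-valued inner product on `Γ₀(E)`: `⟨ξ, η⟩(b) = ⟨ξ(b), η(b)⟩`. -/
def C0Sections.innerC0 (ξ η : C0Sections F E) : C₀(B, ℂ) where
  toFun b := inner ℂ (ξ b) (η b)
  continuous_toFun := by
    have h : Continuous fun b => (⟨b, (ξ b, η b)⟩ : TotalSpace (F × F) (E ×ᵇ E)) :=
      (FiberBundle.Prod.isInducing_diag F E F E).continuous_iff.2 (ξ.2.1.prodMk η.2.1)
    exact (IsHermitianBundle.continuous_inner (F := F) (E := E)).comp h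
  zero_at_infty' := by
    rw [tendsto_zero_iff_norm_tendsto_zero]
    have h := ξ.2.2.mul η.2.2
    rw [mul_zero] at h
    exact squeeze_zero (fun _ => norm_nonneg _) (fun b => norm_inner_le_norm _ _) h

instance : Norm (C0Sections F E) := ⟨fun ξ => √‖C0Sections.innerC0 ξ ξ‖⟩

instance : CStarModule C₀(B, ℂ) (C0Sections F E) where
  inner := C0Sections.innerC0
  inner_add_right := by intros; ext b; exact inner_add_right _ _ _
  inner_self_nonneg := by
    intro ξ b
    exact RCLike.nonneg_iff.2 ⟨inner_self_nonneg, inner_self_im (𝕜 := ℂ) (ξ b)⟩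
  inner_self := by
    intro ξ
    refine ⟨fun h => ?_, ?_⟩
    · ext b
      exact inner_self_eq_zero.1 (DFunLike.congr_fun h b)
    · rintro rfl
      ext b
      exact inner_zero_left _
  inner_op_smul_right := by intros; ext b; exact inner_smul_right _ _ _
  inner_smul_right_complex := by intros; ext b; exact inner_smul_right _ _ _
  star_inner ξ η := by ext b; exact inner_conj_symm _ _
  norm_eq_sqrt_norm_inner_self _ := rfl

theorem C0Sections.inner_apply (ξ η : C0Sections F E) (b : B) :
    (inner C₀(B, ℂ) ξ η) b = inner ℂ (ξ b) (η b) := rfl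

end Sections

/-! ### The group of unitary normalizers of the diagonal matrices -/

section Group

open Matrix

/-- The group `𝒰(N_{D_n})` of all unitary `n × n` matrices `u` such that `u⋆ D_n u ⊆ D_n` and
`u D_n u⋆ ⊆ D_n`, where `D_n` is the algebra of diagonal matrices. -/
def unitaryNormalizer (n : ℕ) : Subgroup (unitaryGroup (Fin n) ℂ) where
  carrier := {u | ∀ d : Matrix (Fin n) (Fin n) ℂ, d.IsDiag →
    (star (u : Matrix (Fin n) (Fin n) ℂ) * d * u).IsDiag ∧
    ((u : Matrix (Fin n) (Fin n) ℂ) * d * star (u : Matrix (Fin n) (Fin n) ℂ)).IsDiag}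
  mul_mem' := by
    intro a b ha hb d hd
    have h1 := (hb _ (ha d hd).1).1
    have h2 := (ha _ (hb d hd).2).2
    constructor
    · simpa [star_mul, mul_assoc] using h1
    · simpa [star_mul, mul_assoc] using h2
  one_mem' := by
    intro d hd
    simpa using hd
  inv_mem' := by
    intro a ha d hd
    have h := ha d hd
    simpa [and_comm] using h.symm

/-- The topological group `𝒰(N_{D_n})`. -/
def UnitaryNormalizer (n : ℕ) : Type := ↥(unitaryNormalizer n)

variable {n : ℕ}

instance : Group (UnitaryNormalizer n) := inferInstanceAs (Group (unitaryNormalizer n))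

instance : TopologicalSpace (UnitaryNormalizer n) :=
  inferInstanceAs (TopologicalSpace (unitaryNormalizer n))

instance : IsTopologicalGroup (UnitaryNormalizer n) :=
  inferInstanceAs (IsTopologicalGroup (unitaryNormalizer n))

/-- The matrix of an element of `𝒰(N_{D_n})`. -/
def UnitaryNormalizer.mat (u : UnitaryNormalizer n) : Matrix (Fin n) (Fin n) ℂ := u.1.1

theorem UnitaryNormalizer.mat_mul (u v : UnitaryNormalizer n) : (u * v).mat = u.mat * v.mat := rfl

theorem UnitaryNormalizer.mat_one : (1 : UnitaryNormalizer n).mat = 1 := rfl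

theorem UnitaryNormalizer.star_mul_mat (u : UnitaryNormalizer n) : star u.mat * u.mat = 1 :=
  (Unitary.mem_iff.1 u.1.2).1

theorem UnitaryNormalizer.continuous_mat :
    Continuous (UnitaryNormalizer.mat : UnitaryNormalizer n → Matrix (Fin n) (Fin n) ℂ) :=
  continuous_subtype_val.comp continuous_subtype_val

theorem UnitaryNormalizer.exists_ne_zero (u : UnitaryNormalizer n) (k : Fin n) :
    ∃ l, u.mat l k ≠ 0 := by
  by_contra! h
  have h1 := congrFun (congrFun u.star_mul_mat k) k
  simp [Matrix.mul_apply, h] at h1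

/-- Every column of `u` has at most one nonzero entry. -/
theorem UnitaryNormalizer.col_unique (u : UnitaryNormalizer n) {k l l' : Fin n}
    (h : u.mat l k ≠ 0) (h' : u.mat l' k ≠ 0) : l = l' := by
  by_contra hne
  have h1 := (u.2 (Matrix.single k k 1) (by
    intro i j hij
    simp only [Matrix.single_apply, ite_eq_right_iff, and_imp]
    rintro rfl rfl
    exact absurd rfl hij)).2 hne
  simp only [Matrix.mul_apply, Matrix.single_apply] at h1
  simp [ite_and] at h1
  rcases h1 with h1 | h1
  · exact h h1
  · exact h' h1

/-- Every row of `u` has at most one nonzero entry. -/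
theorem UnitaryNormalizer.row_unique (u : UnitaryNormalizer n) {k k' l : Fin n}
    (h : u.mat l k ≠ 0) (h' : u.mat l k' ≠ 0) : k = k' := by
  by_contra hne
  have h1 := (u.2 (Matrix.single l l 1) (by
    intro i j hij
    simp only [Matrix.single_apply, ite_eq_right_iff, and_imp]
    rintro rfl rfl
    exact absurd rfl hij)).1 hne
  simp only [Matrix.mul_apply, Matrix.single_apply] at h1
  simp [ite_and] at h1
  rcases h1 with h1 | h1
  · exact h h1
  · exact h' h1

/-- The index `σ(k)` of the nonzero entry in the `k`-th column of `u = λσ`. -/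
def UnitaryNormalizer.index (u : UnitaryNormalizer n) (k : Fin n) : Fin n :=
  (u.exists_ne_zero k).choose

theorem UnitaryNormalizer.mat_index_ne_zero (u : UnitaryNormalizer n) (k : Fin n) :
    u.mat (u.index k) k ≠ 0 := (u.exists_ne_zero k).choose_spec

theorem UnitaryNormalizer.index_eq (u : UnitaryNormalizer n) {k l : Fin n} (h : u.mat l k ≠ 0) :
    u.index k = l := u.col_unique (u.mat_index_ne_zero k) h

theorem UnitaryNormalizer.mat_mul_index (u v : UnitaryNormalizer n) (k : Fin n) :
    (u * v).mat (u.index (v.index k)) k =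
      u.mat (u.index (v.index k)) (v.index k) * v.mat (v.index k) k := by
  rw [UnitaryNormalizer.mat_mul, Matrix.mul_apply]
  refine Finset.sum_eq_single _ (fun l _ hl => ?_) (by simp)
  rw [mul_eq_zero]
  right
  by_contra h
  exact hl (v.index_eq h).symm

theorem UnitaryNormalizer.index_mul (u v : UnitaryNormalizer n) (k : Fin n) :
    (u * v).index k = u.index (v.index k) := by
  apply UnitaryNormalizer.index_eq
  rw [UnitaryNormalizer.mat_mul_index]
  exact mul_ne_zero (u.mat_index_ne_zero _) (v.mat_index_ne_zero _)

/-- The action of `𝒰(N_{D_n})` on `{1, …, n} × ℂ`: if `u = λσ` with a permutation `σ` and a diagonal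
matrix `λ`, then `u · (k, z) = (σ(k), λ_{σ(k)} z)`; note that `λ_{σ(k)}` is the entry of `u` in row
`σ(k)` and column `k`. -/
instance : MulAction (UnitaryNormalizer n) (Fin n × ℂ) where
  smul u q := (u.index q.1, u.mat (u.index q.1) q.1 * q.2)
  one_smul := by
    rintro ⟨k, z⟩
    have h : (1 : UnitaryNormalizer n).index k = k :=
      UnitaryNormalizer.index_eq _ (by simp [UnitaryNormalizer.mat_one])
    refine Prod.ext h ?_
    change (1 : UnitaryNormalizer n).mat ((1 : UnitaryNormalizer n).index k) k * z = z
    simp [h, UnitaryNormalizer.mat_one]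
  mul_smul := by
    rintro u v ⟨k, z⟩
    refine Prod.ext (UnitaryNormalizer.index_mul u v k) ?_
    change (u * v).mat ((u * v).index k) k * z =
      u.mat (u.index (v.index k)) (v.index k) * (v.mat (v.index k) k * z)
    rw [UnitaryNormalizer.index_mul, UnitaryNormalizer.mat_mul_index, mul_assoc]

theorem UnitaryNormalizer.smul_pair (u : UnitaryNormalizer n) (k : Fin n) (z : ℂ) :
    u • (k, z) = (u.index k, u.mat (u.index k) k * z) := rfl

/-- The action of `𝒰(N_{D_n})` on `ℂⁿ` by matrix multiplication. -/
instance : DistribMulAction (UnitaryNormalizer n) (EuclideanSpace ℂ (Fin n)) where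
  smul u v := WithLp.toLp 2 (u.mat *ᵥ v.ofLp)
  one_smul v := by
    change WithLp.toLp 2 ((1 : UnitaryNormalizer n).mat *ᵥ v.ofLp) = v
    rw [UnitaryNormalizer.mat_one, one_mulVec]
  mul_smul u w v := by
    change WithLp.toLp 2 ((u * w).mat *ᵥ v.ofLp) = WithLp.toLp 2 (u.mat *ᵥ (w.mat *ᵥ v.ofLp))
    rw [UnitaryNormalizer.mat_mul, mulVec_mulVec]
  smul_zero u := by
    change WithLp.toLp 2 (u.mat *ᵥ 0) = 0
    rw [mulVec_zero]; rfl
  smul_add u v w := by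
    change WithLp.toLp 2 (u.mat *ᵥ (v.ofLp + w.ofLp)) = _
    rw [mulVec_add]; rfl

theorem UnitaryNormalizer.smul_vec (u : UnitaryNormalizer n) (v : EuclideanSpace ℂ (Fin n)) :
    u • v = WithLp.toLp 2 (u.mat *ᵥ v.ofLp) := rfl

instance : SMulCommClass (UnitaryNormalizer n) ℂ (EuclideanSpace ℂ (Fin n)) where
  smul_comm u c v := by
    simp only [UnitaryNormalizer.smul_vec, WithLp.ofLp_smul, mulVec_smul, WithLp.toLp_smul]

instance : ContinuousSMul (UnitaryNormalizer n) (EuclideanSpace ℂ (Fin n)) where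
  continuous_smul := by
    have h : Continuous fun q : UnitaryNormalizer n × EuclideanSpace ℂ (Fin n) =>
        q.1.mat *ᵥ q.2.ofLp :=
      (UnitaryNormalizer.continuous_mat.comp continuous_fst).matrix_mulVec
        ((PiLp.continuous_ofLp 2 _).comp continuous_snd)
    exact (PiLp.continuous_toLp 2 _).comp h

theorem UnitaryNormalizer.inner_smul_smul (u : UnitaryNormalizer n)
    (v w : EuclideanSpace ℂ (Fin n)) : inner ℂ (u • v) (u • w) = inner ℂ v w := by
  simp only [UnitaryNormalizer.smul_vec, EuclideanSpace.inner_eq_star_dotProduct]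
  rw [star_mulVec, dotProduct_comm, ← dotProduct_mulVec, mulVec_mulVec, ← star_eq_conjTranspose,
    u.star_mul_mat, one_mulVec, dotProduct_comm]

/-- The unitary map of `ℂⁿ` given by an element of `𝒰(N_{D_n})`. -/
def UnitaryNormalizer.toIsometry (u : UnitaryNormalizer n) :
    EuclideanSpace ℂ (Fin n) ≃ₗᵢ[ℂ] EuclideanSpace ℂ (Fin n) :=
  LinearEquiv.isometryOfInner
    { toFun := fun v => u • v
      invFun := fun v => u⁻¹ • v
      map_add' := smul_add u
      map_smul' := fun c v => smul_comm u c v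
      left_inv := inv_smul_smul u
      right_inv := smul_inv_smul u }
    u.inner_smul_smul


end Group

/-! ### Principal bundles and associated fibre bundles -/

section Principal

/-- A (locally trivial) principal `G`-bundle `(P, p, X)`: a space `P` with a continuous right action
of `G` and a continuous `G`-invariant map `p : P → X` such that every point of `X` has an open
neighbourhood `U` with a `G`-equivariant base-preserving homeomorphism `p⁻¹(U) ≅ U × G`. In
particular, the action is free and has a continuous translation function, the fibres of `p` are its
orbits, and `P` is locally compact Hausdorff if `X` and `G` are. -/
structure PrincipalBundle (G : Type w) [Group G] [TopologicalSpace G]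
    (X : Type u) [TopologicalSpace X] where
  carrier : Type p
  [top : TopologicalSpace carrier]
  [act : MulAction Gᵐᵒᵖ carrier]
  [cont : ContinuousSMul Gᵐᵒᵖ carrier]
  proj : carrier → X
  continuous_proj : Continuous proj
  proj_act : ∀ (α : carrier) (g : G), proj (α <• g) = proj α
  exists_chart : ∀ x : X, ∃ e : Trivialization G proj, x ∈ e.baseSet ∧
    ∀ α ∈ e.source, ∀ g : G, (e (α <• g)).2 = (e α).2 * g

attribute [instance] PrincipalBundle.top PrincipalBundle.act PrincipalBundle.cont

namespace PrincipalBundle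

variable {G : Type w} [Group G] [TopologicalSpace G] {X : Type u} [TopologicalSpace X]
  (P : PrincipalBundle.{u, w, p} G X)

/-- A chart of a principal bundle: a `G`-equivariant local trivialization. -/
structure Chart where
  triv : Trivialization G P.proj
  equivariant : ∀ α ∈ triv.source, ∀ g : G, (triv (α <• g)).2 = (triv α).2 * g

/-- A chart around `x`. -/
def chartAt (x : X) : P.Chart := ⟨(P.exists_chart x).choose, (P.exists_chart x).choose_spec.2⟩

theorem mem_chartAt (x : X) : x ∈ (P.chartAt x).triv.baseSet :=
  (P.exists_chart x).choose_spec.1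

variable {P}

/-- The local section of `P` given by a chart. -/
def Chart.sec (e : P.Chart) (x : X) : P.carrier := e.triv.toOpenPartialHomeomorph.symm (x, 1)

theorem Chart.proj_sec (e : P.Chart) {x : X} (hx : x ∈ e.triv.baseSet) : P.proj (e.sec x) = x :=
  e.triv.proj_symm_apply' hx

theorem Chart.triv_sec (e : P.Chart) {x : X} (hx : x ∈ e.triv.baseSet) :
    e.triv (e.sec x) = (x, 1) := e.triv.apply_symm_apply' hx

theorem Chart.mem_source (e : P.Chart) {α : P.carrier} :
    α ∈ e.triv.source ↔ P.proj α ∈ e.triv.baseSet := e.triv.mem_source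

theorem Chart.continuousOn_sec (e : P.Chart) : ContinuousOn e.sec e.triv.baseSet := by
  refine e.triv.continuousOn_invFun.comp (by fun_prop) ?_
  intro x hx
  exact e.triv.mem_target.2 hx

/-- Every point over the chart domain is a translate of the local section. -/
theorem Chart.sec_act (e : P.Chart) {α : P.carrier} (hα : P.proj α ∈ e.triv.baseSet) :
    e.sec (P.proj α) <• (e.triv α).2 = α := by
  have h0 : e.sec (P.proj α) ∈ e.triv.source := by
    rw [e.mem_source, e.proj_sec hα]; exact hα
  have h1 : e.sec (P.proj α) <• (e.triv α).2 ∈ e.triv.source := by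
    rw [e.mem_source, P.proj_act, e.proj_sec hα]; exact hα
  have h2 : e.triv (e.sec (P.proj α) <• (e.triv α).2) = e.triv α := by
    refine Prod.ext ?_ ?_
    · rw [e.triv.coe_fst h1, e.triv.coe_fst (e.mem_source.2 hα), P.proj_act, e.proj_sec hα]
    · rw [e.equivariant _ h0, e.triv_sec hα, one_mul]
  exact e.triv.injOn h1 (e.mem_source.2 hα) h2

theorem surjective_proj : Surjective P.proj := fun x =>
  ⟨(P.chartAt x).sec x, (P.chartAt x).proj_sec (P.mem_chartAt x)⟩

theorem exists_act {α β : P.carrier} (h : P.proj α = P.proj β) : ∃ g : G, α <• g = β := by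
  obtain ⟨e, he⟩ : ∃ e : P.Chart, P.proj α ∈ e.triv.baseSet := ⟨_, P.mem_chartAt _⟩
  have h1 := e.sec_act he
  have h2 := e.sec_act (α := β) (h ▸ he)
  rw [← h] at h2
  refine ⟨(e.triv α).2⁻¹ * (e.triv β).2, ?_⟩
  calc α <• ((e.triv α).2⁻¹ * (e.triv β).2)
      = (e.sec (P.proj α) <• (e.triv α).2) <• ((e.triv α).2⁻¹ * (e.triv β).2) := by rw [h1]
    _ = β := by rw [op_smul_op_smul, mul_inv_cancel_left, h2]

theorem act_eq_self {α : P.carrier} {g : G} (h : α <• g = α) : g = 1 := by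
  have hs : α ∈ (P.chartAt (P.proj α)).triv.source :=
    (P.chartAt (P.proj α)).mem_source.2 (P.mem_chartAt _)
  have h1 := (P.chartAt (P.proj α)).equivariant α hs g
  rw [h] at h1
  exact (mul_eq_left.1 h1.symm)

variable (P)

/-- The equivalence relation on `P × F` that identifies `(α, t)` with `(α g, g⁻¹ t)`. -/
def assocSetoid (F : Type v) [MulAction G F] : Setoid (P.carrier × F) where
  r a b := ∃ g : G, b = (a.1 <• g, g⁻¹ • a.2)
  iseqv :=
    { refl := fun a => ⟨1, by simp⟩
      symm := by
        rintro a b ⟨g, rfl⟩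
        exact ⟨g⁻¹, by simp⟩
      trans := by
        rintro a b c ⟨g, rfl⟩ ⟨h, rfl⟩
        exact ⟨g * h, by simp [mul_smul]⟩ }

/-- The total space `(P × F)/G` of the fibre bundle with fibre `F` associated to `P`, with the
quotient topology. -/
def Assoc (F : Type v) [MulAction G F] : Type (max p v) := Quotient (P.assocSetoid F)

section Assoc

variable {F : Type v} [MulAction G F]

instance [TopologicalSpace F] : TopologicalSpace (P.Assoc F) :=
  inferInstanceAs (TopologicalSpace (Quotient (P.assocSetoid F)))

variable {P}

/-- The class `[α, t]`. -/
def Assoc.mk (α : P.carrier) (t : F) : P.Assoc F := Quotient.mk (P.assocSetoid F) (α, t)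

theorem Assoc.mk_eq_mk {α β : P.carrier} {t t' : F} :
    (Assoc.mk α t : P.Assoc F) = Assoc.mk β t' ↔ ∃ g : G, β = α <• g ∧ t' = g⁻¹ • t := by
  refine (Quotient.eq (r := P.assocSetoid F)).trans ?_
  change (∃ g : G, (β, t') = (α <• g, g⁻¹ • t)) ↔ _
  simp only [Prod.mk.injEq]

theorem Assoc.mk_act (α : P.carrier) (g : G) (t : F) :
    (Assoc.mk (α <• g) t : P.Assoc F) = Assoc.mk α (g • t) :=
  Eq.symm (Assoc.mk_eq_mk.2 ⟨g, rfl, by simp⟩)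

theorem Assoc.ind {C : P.Assoc F → Prop} (h : ∀ α t, C (Assoc.mk α t)) (a : P.Assoc F) : C a :=
  Quotient.ind (fun q => h q.1 q.2) a

/-- The bundle projection `[α, t] ↦ p(α)`. -/
def Assoc.proj : P.Assoc F → X := Quotient.lift (fun q => P.proj q.1) (by
  rintro a b ⟨g, rfl⟩
  exact (P.proj_act _ _).symm)

@[simp] theorem Assoc.proj_mk (α : P.carrier) (t : F) :
    Assoc.proj (Assoc.mk α t : P.Assoc F) = P.proj α := rfl

variable [TopologicalSpace F]

theorem Assoc.continuous_mk : Continuous fun q : P.carrier × F => (Assoc.mk q.1 q.2 : P.Assoc F) :=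
  continuous_quotient_mk'

theorem Assoc.continuous_proj : Continuous (Assoc.proj : P.Assoc F → X) :=
  (P.continuous_proj.comp continuous_fst).quotient_lift _

theorem Assoc.isOpenQuotientMap_mk [ContinuousConstSMul G F] :
    IsOpenQuotientMap fun q : P.carrier × F => (Assoc.mk q.1 q.2 : P.Assoc F) where
  surjective := Quotient.mk_surjective
  continuous := Assoc.continuous_mk
  isOpenMap := by
    intro U hU
    refine isOpen_coinduced.2 ?_
    have h : (Quotient.mk (P.assocSetoid F)) ⁻¹'
        ((fun q : P.carrier × F => (Assoc.mk q.1 q.2 : P.Assoc F)) '' U) =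
        ⋃ g : G, (fun q : P.carrier × F => (q.1 <• g, g⁻¹ • q.2)) ⁻¹' U := by
      ext q
      simp only [Set.mem_preimage, Set.mem_iUnion]
      constructor
      · rintro ⟨a, ha, hq⟩
        obtain ⟨g, h1, h2⟩ := Assoc.mk_eq_mk.1 (show (Assoc.mk q.1 q.2 : P.Assoc F) =
          Assoc.mk a.1 a.2 from hq.symm)
        exact ⟨g, by rw [← h1, ← h2]; exact ha⟩
      · rintro ⟨g, hg⟩
        exact ⟨_, hg, Eq.symm (Assoc.mk_eq_mk.2 ⟨g, rfl, rfl⟩)⟩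
    refine Eq.mpr (congrArg IsOpen h) (isOpen_iUnion fun g => hU.preimage ?_)
    exact ((continuous_const_smul _).comp continuous_fst).prodMk
      ((continuous_const_smul _).comp continuous_snd)

end Assoc

/-- An isomorphism of principal `G`-bundles over `X`: an equivariant base-preserving
homeomorphism. -/
@[ext]
structure Iso (P P' : PrincipalBundle.{u, w, p} G X) where
  toHomeomorph : P.carrier ≃ₜ P'.carrier
  proj_map : ∀ α, P'.proj (toHomeomorph α) = P.proj α
  map_act : ∀ (α : P.carrier) (g : G), toHomeomorph (α <• g) = toHomeomorph α <• g

/-- The fibre bundle isomorphism `[α, t] ↦ [f(α), t]` induced by an isomorphism `f` of principal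
bundles. -/
def Iso.assocMap {P P' : PrincipalBundle.{u, w, p} G X} (f : P.Iso P') (F : Type v)
    [MulAction G F] : P.Assoc F → P'.Assoc F :=
  Quotient.lift (fun q => Assoc.mk (f.toHomeomorph q.1) q.2) (by
    rintro a b ⟨g, rfl⟩
    exact Assoc.mk_eq_mk.2 ⟨g, f.map_act _ _, rfl⟩)

@[simp] theorem Iso.assocMap_mk {P P' : PrincipalBundle.{u, w, p} G X} (f : P.Iso P') {F : Type v}
    [MulAction G F] (α : P.carrier) (t : F) :
    f.assocMap F (Assoc.mk α t) = Assoc.mk (f.toHomeomorph α) t := rfl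

theorem Iso.proj_assocMap {P P' : PrincipalBundle.{u, w, p} G X} (f : P.Iso P') {F : Type v}
    [MulAction G F] (a : P.Assoc F) : Assoc.proj (f.assocMap F a) = Assoc.proj a := by
  induction a using Assoc.ind with
  | h α t => exact f.proj_map α

theorem Iso.continuous_assocMap {P P' : PrincipalBundle.{u, w, p} G X} (f : P.Iso P') (F : Type v)
    [MulAction G F] [TopologicalSpace F] : Continuous (f.assocMap F) :=
  Continuous.quotient_lift (Assoc.continuous_mk.comp
    ((f.toHomeomorph.continuous.comp continuous_fst).prodMk continuous_snd)) _

end PrincipalBundle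

end Principal

/-! ### The Hermitian vector bundle `P × ℂⁿ` -/

section AssocVector

variable {n : ℕ} {X : Type u} [TopologicalSpace X]
  (P : PrincipalBundle.{u, 0, p} (UnitaryNormalizer n) X)

namespace PrincipalBundle

/-- The fibre over `x` of the bundle `P × ℂⁿ` associated to `P`. -/
def VecFiber (x : X) : Type p :=
  {a : P.Assoc (EuclideanSpace ℂ (Fin n)) // Assoc.proj a = x}

variable {P}

/-- The class `[α, v]` as an element of the fibre over `x = p(α)`. -/
def VecFiber.mk {x : X} (α : P.carrier) (hα : P.proj α = x) (v : EuclideanSpace ℂ (Fin n)) :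
    P.VecFiber x := ⟨Assoc.mk α v, hα⟩

theorem VecFiber.mk_bijective {x : X} (α : P.carrier) (hα : P.proj α = x) :
    Bijective (VecFiber.mk α hα) := by
  constructor
  · intro v w h
    obtain ⟨g, h1, h2⟩ := Assoc.mk_eq_mk.1 (congrArg Subtype.val h)
    rw [act_eq_self h1.symm] at h2
    simpa using h2.symm
  · rintro ⟨a, ha⟩
    induction a using Assoc.ind with
    | h β w =>
      obtain ⟨g, rfl⟩ := exists_act (hα.trans (ha.symm.trans (Assoc.proj_mk β w)))
      exact ⟨g • w, Subtype.ext (Assoc.mk_act α g w).symm⟩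

/-- The bijection `v ↦ [α, v]` from `ℂⁿ` onto the fibre over `x = p(α)`. -/
def VecFiber.frame {x : X} (α : P.carrier) (hα : P.proj α = x) :
    EuclideanSpace ℂ (Fin n) ≃ P.VecFiber x := Equiv.ofBijective _ (VecFiber.mk_bijective α hα)

/-- The identification of a fibre with `ℂⁿ` given by some point of `P` over `x`. It is used to define
the structure of the fibre, which does not depend on the choice, see `frameIsometry` below. -/
def VecFiber.chosenFrame (x : X) : P.VecFiber x ≃ EuclideanSpace ℂ (Fin n) :=
  (VecFiber.frame (surjective_proj (P := P) x).choose (surjective_proj (P := P) x).choose_spec).symm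

instance (x : X) : AddCommGroup (P.VecFiber x) := (VecFiber.chosenFrame x).addCommGroup

instance (x : X) : Module ℂ (P.VecFiber x) := (VecFiber.chosenFrame x).module ℂ

/-- `chosenFrame` as a linear map. -/
def VecFiber.chosenLinear (x : X) : P.VecFiber x ≃ₗ[ℂ] EuclideanSpace ℂ (Fin n) :=
  (VecFiber.chosenFrame x).linearEquiv ℂ

instance (x : X) : NormedAddCommGroup (P.VecFiber x) :=
  NormedAddCommGroup.induced (P.VecFiber x) (EuclideanSpace ℂ (Fin n)) (VecFiber.chosenLinear x)
    (VecFiber.chosenLinear x).injective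

/-- The metric of `P × ℂⁿ`: `⟨[α, v], [α, w]⟩ = ⟨v, w⟩`. -/
instance (x : X) : InnerProductSpace ℂ (P.VecFiber x) where
  norm_smul_le c a := by
    change ‖VecFiber.chosenLinear x (c • a)‖ ≤ ‖c‖ * ‖VecFiber.chosenLinear x a‖
    rw [map_smul, norm_smul]
  inner a b := inner ℂ (VecFiber.chosenLinear x a) (VecFiber.chosenLinear x b)
  norm_sq_eq_re_inner a := norm_sq_eq_re_inner (𝕜 := ℂ) (VecFiber.chosenLinear x a)
  conj_inner_symm a b := inner_conj_symm _ _
  add_left a b c := by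
    rw [map_add, inner_add_left]
  smul_left a b c := by
    rw [map_smul, inner_smul_left]

/-- For every `α` in `P` over `x`, the map `v ↦ [α, v]` is a linear isometry from `ℂⁿ` onto the
fibre over `x`. -/
def VecFiber.frameIsometry {x : X} (α : P.carrier) (hα : P.proj α = x) :
    EuclideanSpace ℂ (Fin n) ≃ₗᵢ[ℂ] P.VecFiber x := by
  have h : ∃ g : UnitaryNormalizer n, (surjective_proj (P := P) x).choose <• g = α :=
    exists_act ((surjective_proj (P := P) x).choose_spec.trans hα.symm)
  have key : ∀ v, VecFiber.chosenLinear x (VecFiber.mk α hα v) = h.choose • v := by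
    intro v
    have h1 : VecFiber.mk α hα v = VecFiber.frame (surjective_proj (P := P) x).choose
        (surjective_proj (P := P) x).choose_spec (h.choose • v) := by
      apply Subtype.ext
      change (Assoc.mk α v : P.Assoc _) = Assoc.mk _ (h.choose • v)
      rw [← Assoc.mk_act, h.choose_spec]
    rw [h1]
    exact (VecFiber.chosenFrame x).apply_symm_apply (h.choose • v)
  exact
    { toFun := VecFiber.mk α hα
      invFun := (VecFiber.frame α hα).symm
      left_inv := (VecFiber.frame α hα).left_inv
      right_inv := (VecFiber.frame α hα).right_inv
      map_add' := fun v w => by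
        apply (VecFiber.chosenLinear x).injective
        rw [map_add, key, key, key, smul_add]
      map_smul' := fun c v => by
        apply (VecFiber.chosenLinear x).injective
        rw [RingHom.id_apply, map_smul, key, key, smul_comm]
      norm_map' := fun v => by
        change ‖VecFiber.chosenLinear x (VecFiber.mk α hα v)‖ = ‖v‖
        rw [key]
        exact h.choose.toIsometry.norm_map v }

theorem VecFiber.frameIsometry_apply {x : X} (α : P.carrier) (hα : P.proj α = x)
    (v : EuclideanSpace ℂ (Fin n)) : (VecFiber.frameIsometry α hα v).1 = Assoc.mk α v := rfl

/-- The total space of `P × ℂⁿ` as the space of classes `[α, v]`. -/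
def VecFiber.toAssoc (q : TotalSpace (EuclideanSpace ℂ (Fin n)) P.VecFiber) :
    P.Assoc (EuclideanSpace ℂ (Fin n)) := q.2.1

theorem VecFiber.proj_toAssoc (q : TotalSpace (EuclideanSpace ℂ (Fin n)) P.VecFiber) :
    Assoc.proj (VecFiber.toAssoc q) = q.1 := q.2.2

theorem VecFiber.toAssoc_injective : Injective (VecFiber.toAssoc (P := P)) := by
  rintro ⟨x, a, rfl⟩ ⟨y, b, rfl⟩ h
  obtain rfl : a = b := h
  rfl

/-- The total space of `P × ℂⁿ` carries the quotient topology of `(P × ℂⁿ)/𝒰(N_{D_n})`. -/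
instance : TopologicalSpace (TotalSpace (EuclideanSpace ℂ (Fin n)) P.VecFiber) :=
  TopologicalSpace.induced VecFiber.toAssoc inferInstance

theorem VecFiber.isInducing_toAssoc : IsInducing (VecFiber.toAssoc (P := P)) := ⟨rfl⟩

theorem VecFiber.continuous_proj :
    Continuous (TotalSpace.proj : TotalSpace (EuclideanSpace ℂ (Fin n)) P.VecFiber → X) := by
  have h := Assoc.continuous_proj.comp (VecFiber.isInducing_toAssoc (P := P)).continuous
  exact h.congr VecFiber.proj_toAssoc

open Classical in
/-- The coordinate of `[β, w]` in a chart `e`. -/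
def Chart.coord (e : P.Chart) : P.Assoc (EuclideanSpace ℂ (Fin n)) → EuclideanSpace ℂ (Fin n) :=
  fun a => if h : Assoc.proj a ∈ e.triv.baseSet then
    (VecFiber.frameIsometry (e.sec (Assoc.proj a)) (e.proj_sec h)).symm ⟨a, rfl⟩ else 0

theorem Chart.coord_of_mem (e : P.Chart) {x : X} (hx : x ∈ e.triv.baseSet) (a : P.VecFiber x) :
    e.coord a.1 = (VecFiber.frameIsometry (e.sec x) (e.proj_sec hx)).symm a := by
  obtain ⟨a, rfl⟩ := a
  exact dif_pos hx

theorem Chart.coord_mk (e : P.Chart) {β : P.carrier} (hβ : P.proj β ∈ e.triv.baseSet)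
    (w : EuclideanSpace ℂ (Fin n)) : e.coord (Assoc.mk β w) = (e.triv β).2 • w := by
  refine (e.coord_of_mem hβ (VecFiber.mk β rfl w)).trans ?_
  rw [LinearIsometryEquiv.symm_apply_eq]
  apply Subtype.ext
  rw [VecFiber.frameIsometry_apply, ← Assoc.mk_act, e.sec_act hβ]
  rfl

theorem Chart.continuousAt_coord (e : P.Chart) {a : P.Assoc (EuclideanSpace ℂ (Fin n))}
    (ha : Assoc.proj a ∈ e.triv.baseSet) : ContinuousAt e.coord a := by
  induction a using Assoc.ind with
  | h β w =>
    have ho := Assoc.isOpenQuotientMap_mk (P := P) (F := EuclideanSpace ℂ (Fin n))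
    refine (ho.continuousAt_comp_iff (x := (β, w))).1 ?_
    have hβ : P.proj β ∈ e.triv.baseSet := ha
    have h1 : ContinuousAt e.triv β := e.triv.continuousAt (e.mem_source.2 hβ)
    have h2 : ContinuousAt (fun q : P.carrier × EuclideanSpace ℂ (Fin n) =>
        (e.triv q.1).2 • q.2) (β, w) :=
      ((continuousAt_snd.comp h1).comp (x := (β, w)) continuousAt_fst).smul continuousAt_snd
    refine h2.congr ?_
    have h3 : ∀ᶠ q : P.carrier × EuclideanSpace ℂ (Fin n) in 𝓝 (β, w),
        P.proj q.1 ∈ e.triv.baseSet :=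
      (P.continuous_proj.comp continuous_fst).continuousAt.eventually
        (e.triv.open_baseSet.mem_nhds hβ)
    filter_upwards [h3] with q hq
    exact (e.coord_mk hq q.2).symm

open Classical in
/-- The local trivialization of `P × ℂⁿ` induced by a chart of `P`. -/
def Chart.vecTriv (e : P.Chart) :
    Trivialization (EuclideanSpace ℂ (Fin n)) (π (EuclideanSpace ℂ (Fin n)) P.VecFiber) where
  toFun q := (q.1, e.coord q.2.1)
  invFun y := ⟨y.1, if h : y.1 ∈ e.triv.baseSet then
    VecFiber.frameIsometry (e.sec y.1) (e.proj_sec h) y.2 else 0⟩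
  source := π (EuclideanSpace ℂ (Fin n)) P.VecFiber ⁻¹' e.triv.baseSet
  target := e.triv.baseSet ×ˢ Set.univ
  map_source' q hq := ⟨hq, Set.mem_univ _⟩
  map_target' y hy := hy.1
  left_inv' := by
    rintro ⟨x, a⟩ hx
    change x ∈ e.triv.baseSet at hx
    simp only [dif_pos hx, e.coord_of_mem hx, LinearIsometryEquiv.apply_symm_apply]
  right_inv' := by
    rintro ⟨x, v⟩ hx
    have hx' : x ∈ e.triv.baseSet := hx.1
    simp only [dif_pos hx', e.coord_of_mem hx', LinearIsometryEquiv.symm_apply_apply]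
  open_source := e.triv.open_baseSet.preimage VecFiber.continuous_proj
  open_target := e.triv.open_baseSet.prod isOpen_univ
  continuousOn_toFun := by
    intro q hq
    refine ContinuousAt.continuousWithinAt
      (VecFiber.continuous_proj.continuousAt.prodMk ?_)
    have hq' : Assoc.proj (VecFiber.toAssoc q) ∈ e.triv.baseSet := by
      rw [VecFiber.proj_toAssoc]; exact hq
    exact (e.continuousAt_coord hq').comp
      (VecFiber.isInducing_toAssoc (P := P)).continuous.continuousAt
  continuousOn_invFun := by
    rw [VecFiber.isInducing_toAssoc.continuousOn_iff]
    have h : ContinuousOn (fun y : X × EuclideanSpace ℂ (Fin n) =>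
        (Assoc.mk (e.sec y.1) y.2 : P.Assoc (EuclideanSpace ℂ (Fin n))))
        (e.triv.baseSet ×ˢ Set.univ) :=
      Assoc.continuous_mk.comp_continuousOn
        ((e.continuousOn_sec.comp continuousOn_fst fun y hy => hy.1).prodMk continuousOn_snd)
    refine h.congr ?_
    rintro ⟨x, v⟩ hx
    have hx' : x ∈ e.triv.baseSet := hx.1
    simp only [Function.comp_apply, VecFiber.toAssoc, dif_pos hx',
      VecFiber.frameIsometry_apply]
  baseSet := e.triv.baseSet
  open_baseSet := e.triv.open_baseSet
  source_eq := rfl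
  target_eq := rfl
  proj_toFun _ _ := rfl

theorem Chart.vecTriv_apply (e : P.Chart) {x : X} (hx : x ∈ e.triv.baseSet) (a : P.VecFiber x) :
    (e.vecTriv ⟨x, a⟩).2 = (VecFiber.frameIsometry (e.sec x) (e.proj_sec hx)).symm a :=
  e.coord_of_mem hx a

/-- `P × ℂⁿ` is a fibre bundle with fibre `ℂⁿ`. -/
instance : FiberBundle (EuclideanSpace ℂ (Fin n)) P.VecFiber where
  totalSpaceMk_isInducing' x := by
    rw [isInducing_iff_nhds]
    intro a
    set e := P.chartAt x
    have hx : x ∈ e.triv.baseSet := P.mem_chartAt x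
    set φ := VecFiber.frameIsometry (e.sec x) (e.proj_sec hx)
    apply le_antisymm
    · rw [← Filter.tendsto_iff_comap]
      have h : Continuous fun b : P.VecFiber x =>
          (TotalSpace.mk x b : TotalSpace (EuclideanSpace ℂ (Fin n)) P.VecFiber) := by
        rw [VecFiber.isInducing_toAssoc.continuous_iff]
        have h1 : Continuous fun b : P.VecFiber x =>
            (Assoc.mk (e.sec x) (φ.symm b) : P.Assoc (EuclideanSpace ℂ (Fin n))) :=
          Assoc.continuous_mk.comp (continuous_const.prodMk φ.symm.continuous)
        refine h1.congr fun b => ?_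
        change _ = b.1
        rw [← VecFiber.frameIsometry_apply _ (e.proj_sec hx), φ.apply_symm_apply]
      exact h.continuousAt
    · have h2 : ContinuousAt (fun q => (e.vecTriv q).2)
          (TotalSpace.mk x a : TotalSpace (EuclideanSpace ℂ (Fin n)) P.VecFiber) :=
        continuousAt_snd.comp (e.vecTriv.continuousAt (e.vecTriv.mem_source.2 hx))
      have h3 := Filter.comap_mono (m := TotalSpace.mk (E := P.VecFiber) x)
        (Filter.tendsto_iff_comap.1 h2)
      refine h3.trans ?_
      rw [Filter.comap_comap]
      have h4 : ((fun q => (e.vecTriv q).2) ∘ TotalSpace.mk (E := P.VecFiber) x) = φ.symm := by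
        funext b
        exact e.vecTriv_apply hx b
      have h5 : (fun q => (e.vecTriv q).2) (TotalSpace.mk x a) = φ.symm a := e.vecTriv_apply hx a
      rw [h4, h5]
      exact (φ.symm.toHomeomorph.isInducing.nhds_eq_comap a).ge
  trivializationAtlas' := {t | ∃ e : P.Chart, t = e.vecTriv}
  trivializationAt' x := (P.chartAt x).vecTriv
  mem_baseSet_trivializationAt' x := P.mem_chartAt x
  trivialization_mem_atlas' x := ⟨_, rfl⟩

theorem Chart.vecTriv_isLinear (e : P.Chart) : e.vecTriv.IsLinear ℂ where
  linear x hx := by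
    refine ⟨fun a b => ?_, fun c a => ?_⟩
    · rw [e.vecTriv_apply hx, e.vecTriv_apply hx, e.vecTriv_apply hx, map_add]
    · rw [e.vecTriv_apply hx, e.vecTriv_apply hx, map_smul]

/-- `P × ℂⁿ` is a complex vector bundle. -/
instance : VectorBundle ℂ (EuclideanSpace ℂ (Fin n)) P.VecFiber where
  trivialization_linear' := by
    rintro t ⟨e, rfl⟩
    exact e.vecTriv_isLinear
  continuousOn_coordChange' := by
    rintro t t' ⟨e, rfl⟩ ⟨e', rfl⟩
    have := e.vecTriv_isLinear
    have := e'.vecTriv_isLinear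
    rw [continuousOn_clm_apply]
    intro v
    have h : ContinuousOn (fun x => (e'.vecTriv (e.vecTriv.toOpenPartialHomeomorph.symm (x, v))).2)
        (e.vecTriv.baseSet ∩ e'.vecTriv.baseSet) := by
      refine continuous_snd.comp_continuousOn (e'.vecTriv.continuousOn.comp
        (e.vecTriv.continuousOn_invFun.comp (by fun_prop) ?_) ?_)
      · intro x hx
        exact e.vecTriv.mem_target.2 hx.1
      · intro x hx
        rw [e'.vecTriv.mem_source]
        change (e.vecTriv.toOpenPartialHomeomorph.symm (x, v)).proj ∈ _
        rw [e.vecTriv.proj_symm_apply' hx.1]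
        exact hx.2
    refine h.congr fun x hx => ?_
    exact Trivialization.coordChangeL_apply' (R := ℂ) e.vecTriv e'.vecTriv hx v

/-- The inner products of the fibres form a metric on `P × ℂⁿ`. -/
instance : IsHermitianBundle (EuclideanSpace ℂ (Fin n)) P.VecFiber where
  continuous_inner := by
    rw [continuous_iff_continuousAt]
    rintro ⟨x, a, b⟩
    set e := P.chartAt x
    have hx : x ∈ e.triv.baseSet := P.mem_chartAt x
    have hd := (FiberBundle.Prod.isInducing_diag (EuclideanSpace ℂ (Fin n)) P.VecFiber
      (EuclideanSpace ℂ (Fin n)) P.VecFiber).continuous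
    have hc : ∀ c : P.VecFiber x, ContinuousAt (fun q => (e.vecTriv q).2)
        (TotalSpace.mk x c : TotalSpace (EuclideanSpace ℂ (Fin n)) P.VecFiber) := fun c =>
      continuousAt_snd.comp (e.vecTriv.continuousAt (e.vecTriv.mem_source.2 hx))
    have h1 := (hc a).comp (x := TotalSpace.mk x (a, b)) (continuous_fst.comp hd).continuousAt
    have h2 := (hc b).comp (x := TotalSpace.mk x (a, b)) (continuous_snd.comp hd).continuousAt
    refine (h1.inner h2 (𝕜 := ℂ)).congr ?_
    have h3 : ∀ᶠ q : TotalSpace (EuclideanSpace ℂ (Fin n) × EuclideanSpace ℂ (Fin n))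
        (P.VecFiber ×ᵇ P.VecFiber) in 𝓝 ⟨x, a, b⟩, q.1 ∈ e.triv.baseSet :=
      (VecFiber.continuous_proj.comp (continuous_fst.comp hd)).continuousAt.eventually
        (e.triv.open_baseSet.mem_nhds hx)
    filter_upwards [h3] with q hq
    simp only [Function.comp_apply, e.vecTriv_apply hq, LinearIsometryEquiv.inner_map_map]

end PrincipalBundle

end AssocVector

/-! ### Twisted coverings and their Hilbert modules -/

section Twisted

/-- A twisted `n`-sheeted covering `(Z, s, L)` of `X`: a locally compact Hausdorff space `Z`, a
surjective covering map `s : Z → X` all of whose fibres have exactly `n` points, and a Hermitian line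
bundle `L` over `Z`. -/
structure TwistedCovering (X : Type u) [TopologicalSpace X] (n : ℕ) where
  Z : Type v
  [topZ : TopologicalSpace Z]
  [t2Z : T2Space Z]
  [lcZ : LocallyCompactSpace Z]
  s : Z → X
  isCoveringMap : IsCoveringMap s
  surjective : Surjective s
  encard_fiber : ∀ x : X, (s ⁻¹' {x}).encard = n
  L : Z → Type w
  [topL : TopologicalSpace (TotalSpace ℂ L)]
  [normedL : ∀ z, NormedAddCommGroup (L z)]
  [innerL : ∀ z, InnerProductSpace ℂ (L z)]
  [fiberL : FiberBundle ℂ L]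
  [vectorL : VectorBundle ℂ ℂ L]
  [hermitianL : IsHermitianBundle ℂ L]

attribute [instance] TwistedCovering.topZ TwistedCovering.t2Z TwistedCovering.lcZ
  TwistedCovering.topL TwistedCovering.normedL TwistedCovering.innerL TwistedCovering.fiberL
  TwistedCovering.vectorL TwistedCovering.hermitianL

namespace TwistedCovering

variable {X : Type u} [TopologicalSpace X] {n : ℕ} (T : TwistedCovering.{u, v, w} X n)

theorem finite_fiber (x : X) : (T.s ⁻¹' {x}).Finite :=
  Set.finite_of_encard_eq_coe (T.encard_fiber x)

theorem tendsto_fiberSum {g : T.Z → ℂ} (hg : Tendsto g (cocompact T.Z) (𝓝 0)) :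
    Tendsto (fun x => ∑ᶠ z ∈ T.s ⁻¹' {x}, g z) (cocompact X) (𝓝 0) := by
  rw [Metric.tendsto_nhds] at *
  intro ε hε
  obtain ⟨K, hK, hKg⟩ := mem_cocompact.1 (hg (ε / (n + 1)) (by positivity))
  refine mem_cocompact.2 ⟨T.s '' K, hK.image T.isCoveringMap.continuous, fun x hx => ?_⟩
  change dist _ _ < ε
  have hb : ∀ z ∈ (T.finite_fiber x).toFinset, ‖g z‖ ≤ ε / (n + 1) := by
    intro z hz
    have hz' : T.s z = x := (T.finite_fiber x).mem_toFinset.1 hz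
    have : z ∈ Kᶜ := fun h => hx ⟨z, h, hz'⟩
    have h2 : dist (g z) 0 < ε / (n + 1) := hKg this
    rw [dist_zero_right] at h2
    exact h2.le
  have hcard : (T.finite_fiber x).toFinset.card = n := by
    have h := T.encard_fiber x
    rw [(T.finite_fiber x).encard_eq_coe_toFinset_card] at h
    exact_mod_cast h
  rw [dist_zero_right, finsum_mem_eq_finite_toFinset_sum _ (T.finite_fiber x)]
  calc ‖∑ z ∈ (T.finite_fiber x).toFinset, g z‖
      ≤ ∑ z ∈ (T.finite_fiber x).toFinset, ‖g z‖ := norm_sum_le _ _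
    _ ≤ (T.finite_fiber x).toFinset.card • (ε / (n + 1)) := Finset.sum_le_card_nsmul _ _ _ hb
    _ = n * (ε / (n + 1)) := by rw [hcard, nsmul_eq_mul]
    _ < ε := by
      rw [mul_div_assoc', div_lt_iff₀ (by positivity)]
      nlinarith

theorem continuous_fiberSum {g : T.Z → ℂ} (hg : Continuous g) :
    Continuous (fun x => ∑ᶠ z ∈ T.s ⁻¹' {x}, g z) := by
  rw [continuous_iff_continuousAt]
  intro x
  have hev := T.isCoveringMap x
  have hne : Nonempty (T.s ⁻¹' {x}) := by
    obtain ⟨z, hz⟩ := T.surjective x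
    exact ⟨⟨z, hz⟩⟩
  have hfin : Finite (T.s ⁻¹' {x}) := T.finite_fiber x
  set t := hev.toTrivialization with ht
  have hx : x ∈ t.baseSet := hev.mem_toTrivialization_baseSet
  have h1 : ∀ y ∈ t.baseSet, ∑ᶠ i : T.s ⁻¹' {x}, g (t.toOpenPartialHomeomorph.symm (y, i)) =
      ∑ᶠ z ∈ T.s ⁻¹' {y}, g z := by
    intro y hy
    rw [← finsum_mem_univ]
    refine finsum_mem_eq_of_bijOn (fun i => t.toOpenPartialHomeomorph.symm (y, i)) ⟨?_, ?_, ?_⟩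
      fun _ _ => rfl
    · intro i _
      exact t.proj_symm_apply' hy
    · intro i _ j _ hij
      have h := congrArg t hij
      simp only [t.apply_symm_apply' hy] at h
      exact (Prod.ext_iff.1 h).2
    · intro z hz
      have hz' : T.s z = y := hz
      have hzs : z ∈ t.source := t.mem_source.2 (hz' ▸ hy)
      refine ⟨(t z).2, Set.mem_univ _, ?_⟩
      have h : (y, (t z).2) = t z := Prod.ext (by rw [t.coe_fst hzs, hz']) rfl
      simp only [h]
      exact t.toOpenPartialHomeomorph.left_inv hzs
  have h2 : ContinuousAt (fun y => ∑ᶠ i : T.s ⁻¹' {x},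
      g (t.toOpenPartialHomeomorph.symm (y, i))) x := by
    have := Fintype.ofFinite (T.s ⁻¹' {x})
    simp only [finsum_eq_sum_of_fintype]
    refine tendsto_finsetSum _ fun i _ => ?_
    have h3 : ContinuousAt t.toOpenPartialHomeomorph.symm (x, i) :=
      t.continuousAt_symm (t.mem_target.2 hx)
    exact hg.continuousAt.comp (h3.comp (f := fun y => (y, i)) (by fun_prop))
  refine h2.congr ?_
  filter_upwards [t.open_baseSet.mem_nhds hx] with y hy
  exact h1 y hy

/-- Summation over the fibres of `s`, as a map from `C₀(Z)` to `C₀(X)`. -/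
def fiberSum (g : C₀(T.Z, ℂ)) : C₀(X, ℂ) where
  toFun x := ∑ᶠ z ∈ T.s ⁻¹' {x}, g z
  continuous_toFun := T.continuous_fiberSum g.continuous
  zero_at_infty' := T.tendsto_fiberSum g.zero_at_infty'

/-- The vector space `Γ₀(Z, s, L) = Γ₀(L)`, as a right Hilbert `C₀(X)`-module. -/
def Sections : Type _ := C0Sections ℂ T.L

variable {T}

instance : AddCommGroup T.Sections := inferInstanceAs (AddCommGroup (C0Sections ℂ T.L))

instance : Module ℂ T.Sections := inferInstanceAs (Module ℂ (C0Sections ℂ T.L))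

/-- The underlying section of `L`. -/
def Sections.toC0Sections (t : T.Sections) : C0Sections ℂ T.L := t

instance : CoeFun T.Sections fun _ => ∀ z, T.L z := ⟨fun t => t.toC0Sections⟩

/-- The right action of `C₀(X)` on `Γ₀(Z, s, L)`: `(ξ f)(z) = ξ(z) f(s(z))`. -/
instance : SMul C₀(X, ℂ) T.Sections where
  smul f t := C0Sections.mulBounded (fun z => f (T.s z))
    (f.continuous.comp T.isCoveringMap.continuous) ‖f‖ (fun _ => czero_norm_le f _) t.toC0Sections

theorem Sections.smul_apply (f : C₀(X, ℂ)) (t : T.Sections) (z : T.Z) :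
    (f • t) z = f (T.s z) • t z := rfl

/-- The `C₀(X)`-valued inner product of `Γ₀(Z, s, L)`: `⟨ξ, η⟩(x)` is the sum of `⟨ξ, η⟩_L(z)` over
all `z` with `s(z) = x`. -/
def Sections.innerC0 (ξ η : T.Sections) : C₀(X, ℂ) :=
  T.fiberSum (inner C₀(T.Z, ℂ) ξ.toC0Sections η.toC0Sections)

theorem Sections.innerC0_apply (ξ η : T.Sections) (x : X) :
    Sections.innerC0 ξ η x = ∑ᶠ z ∈ T.s ⁻¹' {x}, inner ℂ (ξ z) (η z) := rfl

theorem Sections.innerC0_eq_sum (ξ η : T.Sections) (x : X) :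
    Sections.innerC0 ξ η x = ∑ z ∈ (T.finite_fiber x).toFinset, inner ℂ (ξ z) (η z) := by
  rw [Sections.innerC0_apply, finsum_mem_eq_finite_toFinset_sum _ (T.finite_fiber x)]

instance : Norm T.Sections := ⟨fun ξ => √‖Sections.innerC0 ξ ξ‖⟩

theorem inner_self_nonneg_complex {V : Type*} [NormedAddCommGroup V] [InnerProductSpace ℂ V]
    (v : V) : (0 : ℂ) ≤ inner ℂ v v :=
  RCLike.nonneg_iff.2 ⟨inner_self_nonneg, inner_self_im (𝕜 := ℂ) v⟩

instance : CStarModule C₀(X, ℂ) T.Sections where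
  inner := Sections.innerC0
  inner_add_right := by
    intro ξ η ζ
    ext x
    rw [ZeroAtInftyContinuousMap.add_apply]
    simp only [Sections.innerC0_eq_sum, ← Finset.sum_add_distrib]
    exact Finset.sum_congr rfl fun z _ => inner_add_right _ _ _
  inner_self_nonneg := by
    intro ξ x
    change (0 : ℂ) ≤ Sections.innerC0 ξ ξ x
    rw [Sections.innerC0_eq_sum]
    exact Finset.sum_nonneg fun z _ => inner_self_nonneg_complex _
  inner_self := by
    intro ξ
    constructor
    · intro h
      refine C0Sections.ext fun z => ?_
      have h1 : Sections.innerC0 ξ ξ (T.s z) = 0 := by rw [h]; rfl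
      rw [Sections.innerC0_eq_sum,
        Finset.sum_eq_zero_iff_of_nonneg fun z _ => inner_self_nonneg_complex _] at h1
      exact inner_self_eq_zero.1 (h1 z ((T.finite_fiber _).mem_toFinset.2 rfl))
    · rintro rfl
      ext x
      rw [Sections.innerC0_eq_sum]
      exact Finset.sum_eq_zero fun z _ => inner_zero_left _
  inner_op_smul_right := by
    intro f ξ η
    ext x
    rw [ZeroAtInftyContinuousMap.mul_apply, Sections.innerC0_eq_sum, Sections.innerC0_eq_sum,
      Finset.mul_sum]
    refine Finset.sum_congr rfl fun z hz => ?_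
    have hz' : T.s z = x := (T.finite_fiber x).mem_toFinset.1 hz
    rw [Sections.smul_apply, inner_smul_right, hz']
  inner_smul_right_complex := by
    intro c ξ η
    ext x
    rw [ZeroAtInftyContinuousMap.smul_apply, Sections.innerC0_eq_sum, Sections.innerC0_eq_sum,
      Finset.smul_sum]
    exact Finset.sum_congr rfl fun z _ => inner_smul_right _ _ _
  star_inner ξ η := by
    ext x
    rw [ZeroAtInftyContinuousMap.star_apply, Sections.innerC0_eq_sum, Sections.innerC0_eq_sum,
      star_sum]
    exact Finset.sum_congr rfl fun z _ => inner_conj_symm _ _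
  norm_eq_sqrt_norm_inner_self _ := rfl

end TwistedCovering

end Twisted

/-! ### Isomorphisms and the maps that they induce -/

section Isomorphisms

/-- The section of a bundle given by a right inverse `σ` of the bundle projection. -/
def sectionOfLift {B F : Type*} {E : B → Type*} (σ : B → TotalSpace F E) (h : ∀ b, (σ b).1 = b)
    (b : B) : E b := h b ▸ (σ b).2

theorem mk_sectionOfLift {B F : Type*} {E : B → Type*} (σ : B → TotalSpace F E)
    (h : ∀ b, (σ b).1 = b) (b : B) : TotalSpace.mk b (sectionOfLift σ h b) = σ b := by
  unfold sectionOfLift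
  have key : ∀ (q : TotalSpace F E) (hq : q.1 = b), TotalSpace.mk b (hq ▸ q.2 : E b) = q := by
    rintro ⟨c, v⟩ rfl
    rfl
  exact key _ (h b)

namespace PrincipalBundle.Iso

variable {n : ℕ} {X : Type u} [TopologicalSpace X]
  {P P' : PrincipalBundle.{u, 0, p} (UnitaryNormalizer n) X} (f : P.Iso P')

/-- The inverse isomorphism. -/
def symm : P'.Iso P where
  toHomeomorph := f.toHomeomorph.symm
  proj_map α := by rw [← f.proj_map, f.toHomeomorph.apply_symm_apply]
  map_act α g := by
    apply f.toHomeomorph.injective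
    rw [f.map_act, f.toHomeomorph.apply_symm_apply, f.toHomeomorph.apply_symm_apply]

/-- The map `[α, v] ↦ [f(α), v]` between the fibres over `x` of `P × ℂⁿ` and `P' × ℂⁿ`. -/
def vecMap (x : X) (a : P.VecFiber x) : P'.VecFiber x :=
  ⟨f.assocMap _ a.1, (f.proj_assocMap a.1).trans a.2⟩

theorem vecMap_frame {x : X} (α : P.carrier) (hα : P.proj α = x) (v : EuclideanSpace ℂ (Fin n)) :
    f.vecMap x (VecFiber.frameIsometry α hα v) =
      VecFiber.frameIsometry (f.toHomeomorph α) ((f.proj_map α).trans hα) v := rfl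

/-- `vecMap` is a linear isometry. -/
theorem exists_vecMap_eq (x : X) : ∃ φ : P.VecFiber x ≃ₗᵢ[ℂ] P'.VecFiber x,
    ∀ a, f.vecMap x a = φ a := by
  obtain ⟨α, hα⟩ := P.surjective_proj x
  refine ⟨(VecFiber.frameIsometry α hα).symm.trans
    (VecFiber.frameIsometry (f.toHomeomorph α) ((f.proj_map α).trans hα)), fun a => ?_⟩
  obtain ⟨v, rfl⟩ := (VecFiber.frameIsometry α hα).surjective a
  rw [vecMap_frame]
  simp

theorem symm_vecMap (x : X) (a : P.VecFiber x) : f.symm.vecMap x (f.vecMap x a) = a := by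
  obtain ⟨α, hα⟩ := P.surjective_proj x
  obtain ⟨v, rfl⟩ := (VecFiber.frameIsometry α hα).surjective a
  rw [vecMap_frame, vecMap_frame]
  simp only [symm, f.toHomeomorph.symm_apply_apply]

theorem vecMap_symm (x : X) (a : P'.VecFiber x) : f.vecMap x (f.symm.vecMap x a) = a := by
  obtain ⟨α, hα⟩ := P'.surjective_proj x
  obtain ⟨v, rfl⟩ := (VecFiber.frameIsometry α hα).surjective a
  rw [vecMap_frame, vecMap_frame]
  simp only [symm, f.toHomeomorph.apply_symm_apply]

/-- The map `Γ₀(P × ℂⁿ) → Γ₀(P' × ℂⁿ)` induced by `f`. -/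
def mapSections (ξ : C0Sections (EuclideanSpace ℂ (Fin n)) P.VecFiber) :
    C0Sections (EuclideanSpace ℂ (Fin n)) P'.VecFiber :=
  ⟨fun x => f.vecMap x (ξ x), by
    rw [VecFiber.isInducing_toAssoc.continuous_iff]
    exact (f.continuous_assocMap _).comp
      ((VecFiber.isInducing_toAssoc (P := P)).continuous.comp ξ.2.1), by
    refine ξ.2.2.congr fun x => ?_
    obtain ⟨φ, hφ⟩ := f.exists_vecMap_eq x
    exact ((congrArg norm (hφ (ξ x))).trans (φ.norm_map (ξ x))).symm⟩

theorem mapSections_apply (ξ : C0Sections (EuclideanSpace ℂ (Fin n)) P.VecFiber) (x : X) :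
    f.mapSections ξ x = f.vecMap x (ξ x) := rfl

/-- The isomorphism of right Hilbert `C₀(X)`-modules `Γ₀(P × ℂⁿ) ≅ Γ₀(P' × ℂⁿ)` induced by an
isomorphism of principal bundles. -/
def sectionsIso : HilbertModuleIso C₀(X, ℂ)
    (C0Sections (EuclideanSpace ℂ (Fin n)) P.VecFiber)
    (C0Sections (EuclideanSpace ℂ (Fin n)) P'.VecFiber) where
  toFun := f.mapSections
  invFun := f.symm.mapSections
  left_inv ξ := C0Sections.ext fun x => f.symm_vecMap x _
  right_inv ξ := C0Sections.ext fun x => f.vecMap_symm x _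
  map_add' ξ η := C0Sections.ext fun x => by
    obtain ⟨φ, hφ⟩ := f.exists_vecMap_eq x
    simp only [mapSections_apply, C0Sections.add_apply, hφ, map_add]
  map_smul' c ξ := C0Sections.ext fun x => by
    obtain ⟨φ, hφ⟩ := f.exists_vecMap_eq x
    simp only [mapSections_apply, C0Sections.smul_apply, hφ, map_smul, RingHom.id_apply]
  map_act g ξ := C0Sections.ext fun x => by
    obtain ⟨φ, hφ⟩ := f.exists_vecMap_eq x
    simp only [mapSections_apply, C0Sections.czero_smul_apply, hφ, map_smul]
  inner_map ξ η := by
    ext x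
    obtain ⟨φ, hφ⟩ := f.exists_vecMap_eq x
    simp only [mapSections_apply, C0Sections.inner_apply, hφ, φ.inner_map_map]

end PrincipalBundle.Iso

namespace TwistedCovering

variable {X : Type u} [TopologicalSpace X] {n : ℕ}

/-- An isomorphism of twisted coverings: a homeomorphism `φ : Z → Z'` with `s' ∘ φ = s` and an
isomorphism of Hermitian line bundles from `L` to the pullback `φ^* L'`, that is, a family of linear
isometries `L_z ≅ L'_{φ(z)}` which define a homeomorphism between the total spaces of `L` and `L'`. -/
structure Iso (T T' : TwistedCovering.{u, v, w} X n) where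
  base : T.Z ≃ₜ T'.Z
  s_base : ∀ z, T'.s (base z) = T.s z
  fiber : ∀ z, T.L z ≃ₗᵢ[ℂ] T'.L (base z)
  total : TotalSpace ℂ T.L ≃ₜ TotalSpace ℂ T'.L
  total_mk : ∀ (z : T.Z) (a : T.L z), total ⟨z, a⟩ = ⟨base z, fiber z a⟩

namespace Iso

variable {T T' : TwistedCovering.{u, v, w} X n} (e : T.Iso T')

/-- The section `z' ↦ e(t(φ⁻¹(z')))` of `L'`. -/
def push (t : ∀ z, T.L z) : ∀ z', T'.L z' :=
  sectionOfLift (F := ℂ) (fun z' => e.total ⟨e.base.symm z', t (e.base.symm z')⟩) fun z' => by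
    rw [e.total_mk]
    exact e.base.apply_symm_apply z'

theorem mk_push (t : ∀ z, T.L z) (z' : T'.Z) :
    TotalSpace.mk' ℂ z' (e.push t z') = e.total ⟨e.base.symm z', t (e.base.symm z')⟩ :=
  mk_sectionOfLift _ _ _

theorem push_apply (t : ∀ z, T.L z) (z : T.Z) : e.push t (e.base z) = e.fiber z (t z) := by
  have h := e.mk_push t (e.base z)
  rw [e.base.symm_apply_apply, e.total_mk] at h
  exact TotalSpace.mk_inj.1 h

/-- The map `Γ₀(Z, s, L) → Γ₀(Z', s', L')` induced by an isomorphism of twisted coverings. -/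
def mapSections (t : T.Sections) : T'.Sections :=
  (⟨e.push t, by
    have h : Continuous fun z' => e.total (TotalSpace.mk' ℂ (e.base.symm z') (t (e.base.symm z'))) :=
      e.total.continuous.comp (t.toC0Sections.2.1.comp e.base.symm.continuous)
    exact h.congr fun z' => (e.mk_push t z').symm, by
    have h := t.toC0Sections.2.2.comp e.base.symm.isClosedEmbedding.tendsto_cocompact
    refine h.congr fun z' => ?_
    obtain ⟨z, rfl⟩ := e.base.surjective z'
    change ‖t (e.base.symm (e.base z))‖ = _
    rw [e.push_apply, LinearIsometryEquiv.norm_map, e.base.symm_apply_apply]⟩ :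
    C0Sections ℂ T'.L)

theorem mapSections_apply (t : T.Sections) (z : T.Z) :
    e.mapSections t (e.base z) = e.fiber z (t z) := e.push_apply t z

/-- The inverse map. -/
def invSections (t : T'.Sections) : T.Sections :=
  (⟨fun z => (e.fiber z).symm (t (e.base z)), by
    have h : Continuous fun z => e.total.symm (TotalSpace.mk' ℂ (e.base z) (t (e.base z))) :=
      e.total.symm.continuous.comp (t.toC0Sections.2.1.comp e.base.continuous)
    refine h.congr fun z => ?_
    rw [Homeomorph.symm_apply_eq, e.total_mk, LinearIsometryEquiv.apply_symm_apply], by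
    have h := t.toC0Sections.2.2.comp e.base.isClosedEmbedding.tendsto_cocompact
    refine h.congr fun z => ?_
    rw [LinearIsometryEquiv.norm_map]
    rfl⟩ : C0Sections ℂ T.L)

theorem invSections_apply (t : T'.Sections) (z : T.Z) :
    e.invSections t z = (e.fiber z).symm (t (e.base z)) := rfl

theorem sections_ext {t t' : T'.Sections} (h : ∀ z, t (e.base z) = t' (e.base z)) : t = t' :=
  C0Sections.ext fun z' => by
    obtain ⟨z, rfl⟩ := e.base.surjective z'
    exact h z

/-- The isomorphism of right Hilbert `C₀(X)`-modules `Γ₀(Z, s, L) ≅ Γ₀(Z', s', L')` induced by an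
isomorphism of twisted coverings. -/
def sectionsIso : HilbertModuleIso C₀(X, ℂ) T.Sections T'.Sections where
  toFun := e.mapSections
  invFun := e.invSections
  left_inv t := C0Sections.ext fun z => by
    change e.invSections (e.mapSections t) z = t z
    rw [invSections_apply, mapSections_apply, LinearIsometryEquiv.symm_apply_apply]
  right_inv t := e.sections_ext fun z => by
    rw [mapSections_apply, invSections_apply, LinearIsometryEquiv.apply_symm_apply]
  map_add' t t' := e.sections_ext fun z => by
    rw [mapSections_apply]
    exact ((e.fiber z).map_add _ _).trans
      (congrArg₂ (· + ·) (e.mapSections_apply t z).symm (e.mapSections_apply t' z).symm)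
  map_smul' c t := e.sections_ext fun z => by
    rw [mapSections_apply]
    exact ((e.fiber z).map_smul _ _).trans (congrArg (c • ·) (e.mapSections_apply t z).symm)
  map_act g t := e.sections_ext fun z => by
    rw [mapSections_apply, Sections.smul_apply, Sections.smul_apply, mapSections_apply, map_smul,
      e.s_base]
  inner_map t t' := by
    ext x
    change Sections.innerC0 _ _ x = Sections.innerC0 _ _ x
    rw [Sections.innerC0_apply, Sections.innerC0_apply]
    symm
    refine finsum_mem_eq_of_bijOn e.base ⟨?_, e.base.injective.injOn, ?_⟩ fun z _ => ?_
    · intro z hz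
      exact (e.s_base z).trans hz
    · intro z' hz'
      obtain ⟨z, rfl⟩ := e.base.surjective z'
      exact ⟨z, (e.s_base z).symm.trans hz', rfl⟩
    · rw [mapSections_apply, mapSections_apply, LinearIsometryEquiv.inner_map_map]

end Iso

end TwistedCovering

end Isomorphisms

/-! ### Corresponding principal bundles -/

section Correspondence

variable {X : Type u} [TopologicalSpace X] {n : ℕ}

/-- A principal `𝒰(N_{D_n})`-bundle `P` over `X` corresponds to the twisted covering `(Z, s, L)` if
`(L, s ∘ p_L, X)` is the fibre bundle with fibre `{1, …, n} × ℂ` associated to `P`. Such an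
identification is a homeomorphism `θ` from `P × ({1, …, n} × ℂ)` onto the total space of `L` which
preserves the projections to `X` and, for `α` in `P` and `k` in `{1, …, n}`, restricts to a linear
isometry `c ↦ θ[α, (k, c)]` from `ℂ` onto a fibre of `L`. In particular, it induces a homeomorphism
`[α, k] ↦ p_L(θ[α, (k, 0)])` from `P × {1, …, n}` onto `Z`. -/
structure Correspondence (P : PrincipalBundle.{u, 0, p} (UnitaryNormalizer n) X)
    (T : TwistedCovering.{u, v, w} X n) where
  toHomeomorph : P.Assoc (Fin n × ℂ) ≃ₜ TotalSpace ℂ T.L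
  s_proj : ∀ a, T.s (toHomeomorph a).proj = PrincipalBundle.Assoc.proj a
  exists_isometry : ∀ (α : P.carrier) (k : Fin n), ∃ (z : T.Z) (u : ℂ ≃ₗᵢ[ℂ] T.L z),
    ∀ c : ℂ, toHomeomorph (PrincipalBundle.Assoc.mk α (k, c)) = ⟨z, u c⟩

/-- The isomorphism `f : P → P'` of principal bundles is induced by the isomorphism `e` from
`(Z, s, L)` to `(Z', s', L')`: under the identifications of `L` and `L'` with the bundles associated
to `P` and `P'`, the map `[α, t] ↦ [f(α), t]` is the map `L → L'` given by `e`. -/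
def IsInducedBy {P P' : PrincipalBundle.{u, 0, p} (UnitaryNormalizer n) X}
    {T T' : TwistedCovering.{u, v, w} X n} (f : P.Iso P') (θ : Correspondence P T)
    (θ' : Correspondence P' T') (e : T.Iso T') : Prop :=
  ∀ a : P.Assoc (Fin n × ℂ), θ'.toHomeomorph (f.assocMap _ a) = e.total (θ.toHomeomorph a)

end Correspondence

end TwistedCoverings

end

open TwistedCoverings ZeroAtInfty

noncomputable section

namespace TwistedCoverings

/-! ### Monomial unitary matrices -/

namespace UnitaryNormalizer

open Matrix

variable {n : ℕ}

/-! A frame of `(Z, s, L)` over `x` is an enumeration of the fibre of `s` over `x` together with a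
unit vector in each of the lines of `L` at these points. Two enumerations differ by a permutation
and two unit vectors of one complex line differ by a phase, so `𝒰(N_{D_n})` acts simply transitively
on the frames over `x`. The frames thus form the principal bundle that is wanted, and `(α, (k, c)) ↦
c α(k)` identifies its associated bundle with `L`. Local triviality comes from the sheets of the
covering and from local unit sections of `L`. The entries of the `g` with `α g = β` are the pairings
of vectors of `α` and `β` (`mat_eq_pair`); they are continuous because `s` is locally injective
(`continuousOn_pair`).

Every correspondence `θ` is governed by frames as well: `θ` is linear in `c`, so it is determined by
`α ↦ (k ↦ θ[α, (k, 1)])`. This is a continuous equivariant map from `P` to the bundle of frames,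
hence a homeomorphism (`frameHomeomorph`). An isomorphism `e` acts on frames by composition, and the
induced isomorphism `P → P'` is this action read through the two homeomorphisms. That gives
existence and uniqueness at once.

For the Hilbert modules, a frame `α` over `x` gives the unitary map from `ℂⁿ` onto the direct sum of
the lines `L_z` with `s(z) = x` that sends `v` to the family `v_k α(k)` (`comb`,
`finsum_inner_comb`). Replacing `α` by `α g` replaces `v` by `g v` (`comb_act`), so the map descends
to the fibre of `P × ℂⁿ`. Continuity is local, since the index of a sheet is locally constant.
Vanishing at infinity passes to `Z` because `s` is proper and back to `X` because the fibres are
finite. Naturality holds because `e` maps `α` to `e ∘ α` and leaves the coordinates `v` alone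
(`comb_frameMap`). -/

theorem mat_injective : Injective (mat : UnitaryNormalizer n → Matrix (Fin n) (Fin n) ℂ) :=
  Subtype.val_injective.comp Subtype.val_injective

theorem isInducing_mat : IsInducing (mat : UnitaryNormalizer n → Matrix (Fin n) (Fin n) ℂ) :=
  IsInducing.subtypeVal.comp IsInducing.subtypeVal

theorem mat_eq_zero (u : UnitaryNormalizer n) {k l : Fin n} (h : l ≠ u.index k) :
    u.mat l k = 0 := by
  by_contra h'
  exact h (u.index_eq h').symm

/-- Row `σ(k)` has its only nonzero entry in column `k`, so the sum has a single term. -/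
theorem mulVec_index (u : UnitaryNormalizer n) (v : Fin n → ℂ) (k : Fin n) :
    (u.mat *ᵥ v) (u.index k) = u.mat (u.index k) k * v k := by
  refine Finset.sum_eq_single k (fun j _ hj => mul_eq_zero_of_left ?_ _)
    fun h => absurd (Finset.mem_univ k) h
  exact not_not.1 fun h => hj (u.row_unique h (u.mat_index_ne_zero k))

theorem index_injective (u : UnitaryNormalizer n) : Injective u.index := fun j k h =>
  u.row_unique (u.mat_index_ne_zero j) (h ▸ u.mat_index_ne_zero k)

/-- This is the `k`-th diagonal entry of `u⋆ u = 1`, to which column `k` contributes only its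
nonzero entry. -/
theorem conj_mul_mat_index (u : UnitaryNormalizer n) (k : Fin n) :
    star (u.mat (u.index k) k) * u.mat (u.index k) k = 1 := by
  have h := congrFun (congrFun u.star_mul_mat k) k
  rw [Matrix.mul_apply, one_apply_eq, Finset.sum_eq_single (u.index k)
    (fun l _ hl => by rw [u.mat_eq_zero hl, mul_zero]) (by simp)] at h
  exact h

theorem norm_mat_index (u : UnitaryNormalizer n) (k : Fin n) : ‖u.mat (u.index k) k‖ = 1 := by
  have h := congrArg norm (u.conj_mul_mat_index k)
  rw [norm_mul, norm_star, norm_one] at h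
  nlinarith [norm_nonneg (u.mat (u.index k) k)]

/-- The condition `σ(k) = l` means that the entry in row `l` and column `k` is nonzero, which is an
open condition; so the permutation part of `u` is locally constant. -/
theorem continuous_index (k : Fin n) : Continuous fun u : UnitaryNormalizer n => u.index k := by
  rw [continuous_discrete_rng]
  intro l
  have h : (fun u : UnitaryNormalizer n => u.index k) ⁻¹' {l} = {u | u.mat l k ≠ 0} := by
    ext u
    exact ⟨fun h => h ▸ u.mat_index_ne_zero k, fun h => u.index_eq h⟩
  rw [h]
  exact isOpen_ne_fun (continuous_mat.matrix_elem l k) continuous_const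

/-- The row that is read off varies with `u`, but rows form a discrete space, so the entry is
jointly continuous in row and matrix. -/
theorem continuous_mat_index (k : Fin n) :
    Continuous fun u : UnitaryNormalizer n => u.mat (u.index k) k := by
  have h : Continuous fun q : Fin n × UnitaryNormalizer n => q.2.mat q.1 k :=
    continuous_prod_of_discrete_left.2 fun l => continuous_mat.matrix_elem l k
  exact h.comp ((continuous_index k).prodMk continuous_id)

/-- The matrix `λσ` with the entry `c k` in row `σ k` and column `k`. -/
def monomial (σ : Equiv.Perm (Fin n)) (c : Fin n → ℂ) : Matrix (Fin n) (Fin n) ℂ :=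
  fun l k => if l = σ k then c k else 0

/-- For `d = 1` this formula yields unitarity, and for general `d` one half of the normalizing
condition. -/
theorem star_monomial_mul_diagonal_mul (σ : Equiv.Perm (Fin n)) (c d : Fin n → ℂ) :
    star (monomial σ c) * diagonal d * monomial σ c =
      diagonal fun k => star (c k) * d (σ k) * c k := by
  ext i j
  rw [Matrix.mul_apply, Finset.sum_eq_single (σ i)]
  · by_cases h : i = j
    · subst h
      simp [monomial, star_apply]
    · simp [monomial, h]
  · intro l _ hl
    simp [monomial, star_apply, hl]
  · simp

theorem monomial_mul_diagonal_mul_star (σ : Equiv.Perm (Fin n)) (c d : Fin n → ℂ) :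
    monomial σ c * diagonal d * star (monomial σ c) =
      diagonal fun k => c (σ.symm k) * d (σ.symm k) * star (c (σ.symm k)) := by
  ext i j
  rw [Matrix.mul_apply, Finset.sum_eq_single (σ.symm i)]
  · by_cases h : i = j
    · subst h
      simp [monomial, star_apply]
    · simp [monomial, h, star_apply, Ne.symm h]
  · intro l _ hl
    have : i ≠ σ l := fun h => hl (by simp [h])
    simp [monomial, star_apply, this]
  · simp

/-- Source of group elements: two frames over one point determine a permutation and phases, and the
matrix built from them has to lie in `𝒰(N_{D_n})`. -/
theorem exists_mat_eq_monomial (σ : Equiv.Perm (Fin n)) (c : Fin n → ℂ) (hc : ∀ k, ‖c k‖ = 1) :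
    ∃ u : UnitaryNormalizer n, u.mat = monomial σ c := by
  have hc' : ∀ k, star (c k) * c k = 1 := fun k => by
    have h := RCLike.conj_mul (c k)
    rw [hc] at h
    simpa using h
  have h1 : monomial σ c ∈ unitaryGroup (Fin n) ℂ := by
    rw [mem_unitaryGroup_iff']
    have h := star_monomial_mul_diagonal_mul σ c 1
    simp only [Pi.one_apply, mul_one, hc'] at h
    simpa using h
  refine ⟨⟨⟨_, h1⟩, fun d hd => ?_⟩, rfl⟩
  obtain ⟨d, rfl⟩ : ∃ d', diagonal d' = d := ⟨_, hd.diagonal_diag⟩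
  constructor
  · change (star (monomial σ c) * diagonal d * monomial σ c).IsDiag
    rw [star_monomial_mul_diagonal_mul]
    exact isDiag_diagonal _
  · change (monomial σ c * diagonal d * star (monomial σ c)).IsDiag
    rw [monomial_mul_diagonal_mul_star]
    exact isDiag_diagonal _

end UnitaryNormalizer

/-! ### The total space of a Hermitian line bundle -/

section TotalSpace

variable {B : Type*} {F : Type*} {E : B → Type*} [∀ b, NormedAddCommGroup (E b)]
  [∀ b, InnerProductSpace ℂ (E b)]

/-- Multiplication of a point of a vector bundle by a scalar. -/
def scale (c : ℂ) (q : TotalSpace F E) : TotalSpace F E := ⟨q.1, c • q.2⟩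

@[simp] theorem scale_mk (c : ℂ) (b : B) (a : E b) :
    scale c (⟨b, a⟩ : TotalSpace F E) = ⟨b, c • a⟩ := rfl

@[simp] theorem proj_scale (c : ℂ) (q : TotalSpace F E) : (scale c q).proj = q.proj := rfl

theorem scale_scale (c d : ℂ) (q : TotalSpace F E) : scale c (scale d q) = scale (c * d) q := by
  obtain ⟨b, a⟩ := q
  simp [mul_smul]

@[simp] theorem scale_one (q : TotalSpace F E) : scale 1 q = q := by
  obtain ⟨b, a⟩ := q
  simp

theorem norm_scale (c : ℂ) (q : TotalSpace F E) : ‖(scale c q).2‖ = ‖c‖ * ‖q.2‖ :=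
  norm_smul (β := E q.1) c q.2

open Classical in
/-- The inner product of two points of a Hermitian bundle in the same fibre, and `0` for points in
different fibres. -/
def pair (q r : TotalSpace F E) : ℂ :=
  if h : r.proj = q.proj then inner ℂ q.2 (h ▸ r.2) else 0

@[simp] theorem pair_mk (b : B) (a a' : E b) :
    pair (⟨b, a⟩ : TotalSpace F E) ⟨b, a'⟩ = inner ℂ a a' := by
  simp [pair]

theorem pair_of_ne {q r : TotalSpace F E} (h : q.proj ≠ r.proj) : pair q r = 0 :=
  dif_neg (Ne.symm h)

theorem pair_scale_right (c : ℂ) (q r : TotalSpace F E) : pair q (scale c r) = c * pair q r := by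
  by_cases h : q.proj = r.proj
  · obtain ⟨b, a⟩ := q
    obtain ⟨b', a'⟩ := r
    obtain rfl : b = b' := h
    simp
  · rw [pair_of_ne h, pair_of_ne (by simpa using h), mul_zero]

theorem pair_self_of_norm {q : TotalSpace F E} (h : ‖q.2‖ = 1) : pair q q = 1 := by
  obtain ⟨b, a⟩ := q
  rw [pair_mk, inner_self_eq_norm_sq_to_K]
  simp only at h
  simp [h]

variable [TopologicalSpace (TotalSpace F E)]

/-- Pairs of points in a common fibre are points of `E ⊕ E`, whose topology is induced from the
product of the total spaces; on `E ⊕ E` the metric is continuous. -/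
theorem continuousOn_pair_of_proj_eq [IsHermitianBundle F E] :
    ContinuousOn (fun p : TotalSpace F E × TotalSpace F E => pair p.1 p.2)
      {p | p.1.proj = p.2.proj} := by
  rw [continuousOn_iff_continuous_domRestrict]
  let m : {p : TotalSpace F E × TotalSpace F E | p.1.proj = p.2.proj} →
      TotalSpace (F × F) (E ×ᵇ E) := fun p => ⟨p.1.1.proj, p.1.1.2, p.2.symm ▸ p.1.2.2⟩
  have hm : Continuous m := by
    rw [(FiberBundle.Prod.isInducing_diag F E F E).continuous_iff]
    refine continuous_subtype_val.congr ?_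
    rintro ⟨⟨⟨b, a⟩, ⟨b', a'⟩⟩, h⟩
    obtain rfl : b = b' := h
    rfl
  refine ((IsHermitianBundle.continuous_inner (F := F) (E := E)).comp hm).congr ?_
  rintro ⟨⟨⟨b, a⟩, ⟨b', a'⟩⟩, h⟩
  obtain rfl : b = b' := h
  simp [m]

theorem continuous_norm_snd [IsHermitianBundle F E] :
    Continuous fun q : TotalSpace F E => ‖q.2‖ := by
  have h : Continuous fun q : TotalSpace F E => pair q q :=
    continuousOn_pair_of_proj_eq.comp_continuous (continuous_id.prodMk continuous_id) fun _ => rfl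
  have h2 : Continuous fun q : TotalSpace F E => √(RCLike.re (pair q q)) :=
    Real.continuous_sqrt.comp (RCLike.continuous_re.comp h)
  refine h2.congr ?_
  rintro ⟨b, a⟩
  rw [pair_mk]
  exact (norm_eq_sqrt_re_inner (𝕜 := ℂ) a).symm

/-- Trivializations are linear on fibres, so in coordinates this is multiplication in `F`. -/
theorem continuous_scale [TopologicalSpace B] [NormedAddCommGroup F] [NormedSpace ℂ F]
    [FiberBundle F E] [VectorBundle ℂ F E] :
    Continuous fun p : ℂ × TotalSpace F E => scale p.1 p.2 := by
  rw [continuous_iff_continuousAt]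
  rintro ⟨c, q⟩
  have hq : ContinuousAt (fun p : ℂ × TotalSpace F E => p.2) (c, q) := continuousAt_snd
  rw [FiberBundle.continuousAt_totalSpace] at hq ⊢
  refine ⟨hq.1, (continuousAt_fst.smul hq.2).congr ?_⟩
  filter_upwards [hq.1 ((trivializationAt F E q.proj).open_baseSet.mem_nhds
    (FiberBundle.mem_baseSet_trivializationAt' q.proj))] with p hp
  exact (((trivializationAt F E q.proj).linear ℂ hp).map_smul p.1 p.2.2).symm

end TotalSpace

/-! ### Unit vectors in complex lines -/

section LineBundle

variable {B : Type*} [TopologicalSpace B] {E : B → Type*} [∀ b, NormedAddCommGroup (E b)]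
  [∀ b, InnerProductSpace ℂ (E b)] [TopologicalSpace (TotalSpace ℂ E)] [FiberBundle ℂ E]
  [VectorBundle ℂ ℂ E]

theorem exists_smul_eq {b : B} {a : E b} (ha : a ≠ 0) (a' : E b) : ∃ c : ℂ, c • a = a' := by
  let φ := (trivializationAt ℂ E b).linearEquivAt ℂ b (FiberBundle.mem_baseSet_trivializationAt' b)
  have h : φ a ≠ 0 := φ.map_ne_zero_iff.2 ha
  refine ⟨φ a' / φ a, φ.injective ?_⟩
  rw [map_smul, smul_eq_mul, div_mul_cancel₀ _ h]

/-- A unit vector is an orthonormal basis of its line. -/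
theorem inner_smul_of_norm {b : B} {a : E b} (ha : ‖a‖ = 1) (a' : E b) :
    (inner ℂ a a' : ℂ) • a = a' := by
  obtain ⟨c, rfl⟩ := exists_smul_eq (norm_ne_zero_iff.1 (ha ▸ one_ne_zero)) a'
  rw [inner_smul_right, inner_self_eq_norm_sq_to_K, ha]
  simp

/-- So `pair q r` is the coordinate of `r` with respect to the unit vector `q`; working in the total
space avoids transport between fibres. -/
theorem scale_pair {q r : TotalSpace ℂ E} (h : q.proj = r.proj) (hq : ‖q.2‖ = 1) :
    scale (pair q r) q = r := by
  obtain ⟨b, a⟩ := q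
  obtain ⟨b', a'⟩ := r
  obtain rfl : b = b' := h
  rw [pair_mk, scale_mk, inner_smul_of_norm hq]

theorem norm_pair {q r : TotalSpace ℂ E} (h : q.proj = r.proj) (hq : ‖q.2‖ = 1) :
    ‖pair q r‖ = ‖r.2‖ := by
  rw [← congrArg (fun q : TotalSpace ℂ E => ‖q.2‖) (scale_pair h hq), norm_scale, hq, mul_one]

/-- Every Hermitian line bundle has local sections of norm `1`. -/
theorem exists_local_unit_section [IsHermitianBundle ℂ E] (b : B) :
    ∃ (U : Set B) (ω : B → TotalSpace ℂ E), IsOpen U ∧ b ∈ U ∧ ContinuousOn ω U ∧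
      ∀ c ∈ U, (ω c).proj = c ∧ ‖(ω c).2‖ = 1 := by
  set t := trivializationAt ℂ E b
  -- The section with constant coordinate `1` has no zeros, but the trivialization need not be
  -- isometric; the section is divided by its norm below.
  let σ : B → TotalSpace ℂ E := fun c => t.toOpenPartialHomeomorph.symm (c, 1)
  have hσ : ContinuousOn σ t.baseSet := t.continuousOn_symm_prodMk_left
  have hp : ∀ c ∈ t.baseSet, (σ c).proj = c := fun c hc => t.proj_symm_apply' hc
  have h0 : ∀ c ∈ t.baseSet, ‖(σ c).2‖ ≠ 0 := by
    intro c hc h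
    rw [norm_eq_zero] at h
    have h1 : t (σ c) = (c, 1) := t.apply_symm_apply' hc
    have h2 : (t (⟨(σ c).proj, (σ c).2⟩ : TotalSpace ℂ E)).2 = 0 := by
      rw [h]
      exact (t.linear ℂ ((hp c hc).symm ▸ hc)).map_zero
    have h3 : (t (σ c)).2 = 0 := h2
    rw [h1] at h3
    exact one_ne_zero h3
  refine ⟨t.baseSet, fun c => scale ((‖(σ c).2‖ : ℂ)⁻¹) (σ c), t.open_baseSet,
    FiberBundle.mem_baseSet_trivializationAt' b, ?_, fun c hc => ⟨hp c hc, ?_⟩⟩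
  · refine continuous_scale.comp_continuousOn (ContinuousOn.prodMk ?_ hσ)
    refine ContinuousOn.inv₀ (Complex.continuous_ofReal.comp_continuousOn
      (continuous_norm_snd.comp_continuousOn hσ)) fun c hc => ?_
    exact_mod_cast h0 c hc
  · rw [norm_scale, norm_inv, Complex.norm_real, norm_norm, inv_mul_cancel₀ (h0 c hc)]

end LineBundle

/-! ### The covering map -/

namespace TwistedCovering

variable {X : Type u} [TopologicalSpace X] {n : ℕ} (T : TwistedCovering.{u, v, w} X n)

/-- Two local lifts to `Z` of the same map to `X` that agree at a point agree near that point. -/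
theorem eventuallyEq_of_lift {Y : Type*} {l : Filter Y} {f g : Y → T.Z} {z : T.Z}
    (hf : Tendsto f l (𝓝 z)) (hg : Tendsto g l (𝓝 z)) (h : ∀ᶠ y in l, T.s (f y) = T.s (g y)) :
    f =ᶠ[l] g := by
  obtain ⟨e, hz, he⟩ := T.isCoveringMap.isLocalHomeomorph z
  filter_upwards [h, hf (e.open_source.mem_nhds hz), hg (e.open_source.mem_nhds hz)]
    with y hy h1 h2
  rw [he] at hy
  exact e.injOn h1 h2 hy

/-- If the image of an ultrafilter converges to `x`, then over a trivializing neighbourhood the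
ultrafilter selects one of the finitely many sheets, and it converges to the point of that sheet
over `x`. -/
theorem isProperMap_s : IsProperMap T.s := by
  rw [isProperMap_iff_ultrafilter]
  refine ⟨T.isCoveringMap.continuous, fun 𝒰 x h => ?_⟩
  have hev := T.isCoveringMap x
  have hne : Nonempty (T.s ⁻¹' {x}) := by
    obtain ⟨z, hz⟩ := T.surjective x
    exact ⟨⟨z, hz⟩⟩
  have hfin : Finite (T.s ⁻¹' {x}) := T.finite_fiber x
  set t := hev.toTrivialization
  have hx : x ∈ t.baseSet := hev.mem_toTrivialization_baseSet
  have h1 : ∀ᶠ z in (𝒰 : Filter T.Z), T.s z ∈ t.baseSet := h (t.open_baseSet.mem_nhds hx)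
  have h2 : ∃ i, ∀ᶠ z in (𝒰 : Filter T.Z), (t z).2 = i :=
    (Ultrafilter.eventually_exists_iff (f := 𝒰)).1 (Eventually.of_forall fun z => ⟨(t z).2, rfl⟩)
  obtain ⟨i, hi⟩ := h2
  refine ⟨t.toOpenPartialHomeomorph.symm (x, i), t.proj_symm_apply' hx, ?_⟩
  have h3 : Tendsto (fun z => t.toOpenPartialHomeomorph.symm (T.s z, i)) 𝒰
      (𝓝 (t.toOpenPartialHomeomorph.symm (x, i))) :=
    (t.continuousAt_symm_prodMk_left hx).tendsto.comp h
  refine (h3.congr' ?_).mono_left le_rfl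
  filter_upwards [h1, hi] with z hz1 hz2
  rw [← hz2]
  exact t.symm_apply_mk_proj (t.mem_source.2 hz1)

/-- Needed to pull sections that vanish at infinity on `X` back to `Z`. -/
theorem tendsto_s_cocompact : Tendsto T.s (cocompact T.Z) (cocompact X) := by
  intro U hU
  obtain ⟨K, hK, hKU⟩ := mem_cocompact.1 hU
  exact mem_cocompact.2 ⟨T.s ⁻¹' K, T.isProperMap_s.isCompact_preimage hK,
    fun z hz => hKU hz⟩

/-- The domain consists of pairs over a common point of `X`. Near a pair in one fibre of `L`, local
injectivity of `s` forces nearby pairs of the domain into one fibre as well, where the metric is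
continuous. Pairs over distinct points of `Z` stay so nearby, as `Z` is Hausdorff, and there `pair`
is `0`. -/
theorem continuousOn_pair :
    ContinuousOn (fun q : TotalSpace ℂ T.L × TotalSpace ℂ T.L => pair q.1 q.2)
      {q | T.s q.1.proj = T.s q.2.proj} := by
  have hc1 : Continuous fun q : TotalSpace ℂ T.L × TotalSpace ℂ T.L => q.1.proj :=
    (FiberBundle.continuous_proj ℂ T.L).comp continuous_fst
  have hc2 : Continuous fun q : TotalSpace ℂ T.L × TotalSpace ℂ T.L => q.2.proj :=
    (FiberBundle.continuous_proj ℂ T.L).comp continuous_snd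
  intro q hq
  by_cases h : q.1.proj = q.2.proj
  · refine (continuousOn_pair_of_proj_eq q h).mono_of_mem_nhdsWithin ?_
    exact T.eventuallyEq_of_lift (hc1.continuousWithinAt (s := _) (x := q))
      (by simp only [h]; exact hc2.continuousWithinAt) self_mem_nhdsWithin
  · refine ContinuousAt.continuousWithinAt ((continuousAt_const (y := (0 : ℂ))).congr ?_)
    filter_upwards [(isOpen_ne_fun hc1 hc2).mem_nhds h] with r hr
    exact (pair_of_ne hr).symm

end TwistedCovering

/-! ### The principal bundle of frames of a twisted covering -/

namespace TwistedCovering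

variable {X : Type u} [TopologicalSpace X] {n : ℕ} (T : TwistedCovering.{u, v, w} X n)

/-- A frame of a twisted covering over a point `x`: an enumeration of the fibre of `s` over `x`
together with a vector of norm `1` in each of the corresponding fibres of `L`. -/
@[ext]
structure Frame where
  vec : Fin n → TotalSpace ℂ T.L
  norm_vec : ∀ k, ‖(vec k).2‖ = 1
  exists_bijOn : ∃ x, Set.BijOn (fun k => (vec k).proj) Set.univ (T.s ⁻¹' {x})

namespace Frame

variable {T}

/-- The vectors alone carry the topology: they determine the base point, which therefore need not be
part of the data. -/
instance : TopologicalSpace T.Frame := TopologicalSpace.induced Frame.vec inferInstance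

theorem isInducing_vec : IsInducing (vec : T.Frame → Fin n → TotalSpace ℂ T.L) := ⟨rfl⟩

theorem continuous_vec (k : Fin n) : Continuous fun α : T.Frame => α.vec k :=
  (continuous_apply k).comp isInducing_vec.continuous

/-- The point of `X` over which the frame lies. -/
def base (α : T.Frame) : X := α.exists_bijOn.choose

theorem bijOn (α : T.Frame) :
    Set.BijOn (fun k => (α.vec k).proj) Set.univ (T.s ⁻¹' {α.base}) :=
  α.exists_bijOn.choose_spec

theorem s_proj (α : T.Frame) (k : Fin n) : T.s (α.vec k).proj = α.base :=
  α.bijOn.mapsTo (Set.mem_univ k)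

theorem proj_injective (α : T.Frame) : Injective fun k => (α.vec k).proj :=
  Set.injOn_univ.1 α.bijOn.injOn

theorem exists_proj_eq (α : T.Frame) {z : T.Z} (hz : T.s z = α.base) :
    ∃ k, (α.vec k).proj = z := by
  obtain ⟨k, -, hk⟩ := α.bijOn.surjOn hz
  exact ⟨k, hk⟩

/-- As `s` is surjective, a frame has at least one index. -/
theorem exists_index (α : T.Frame) : ∃ k, T.s (α.vec k).proj = α.base := by
  obtain ⟨z, hz⟩ := T.surjective α.base
  obtain ⟨k, rfl⟩ := α.exists_proj_eq hz
  exact ⟨k, hz⟩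

theorem base_eq {α : T.Frame} {x : X} (h : ∀ k, T.s (α.vec k).proj = x) : α.base = x := by
  obtain ⟨k, hk⟩ := α.exists_index
  rw [← hk, h]

theorem continuous_base : Continuous (base : T.Frame → X) := by
  rw [continuous_iff_continuousAt]
  intro α
  -- Some index is needed to express `base` as `s` of the projection of a vector; the index supplied
  -- by `α` serves for all frames.
  obtain ⟨k, -⟩ := α.exists_index
  have h : Continuous fun β : T.Frame => T.s (β.vec k).proj :=
    T.isCoveringMap.continuous.comp ((FiberBundle.continuous_proj ℂ T.L).comp (continuous_vec k))
  exact (h.congr fun β => β.s_proj k).continuousAt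

/-- The point `c α(k)` of `L`. -/
def ev (α : T.Frame) (t : Fin n × ℂ) : TotalSpace ℂ T.L := scale t.2 (α.vec t.1)

theorem ev_mk (α : T.Frame) (k : Fin n) (c : ℂ) : α.ev (k, c) = scale c (α.vec k) := rfl

theorem s_proj_ev (α : T.Frame) (t : Fin n × ℂ) : T.s (α.ev t).proj = α.base := α.s_proj t.1

theorem ev_one (α : T.Frame) (k : Fin n) : α.ev (k, 1) = α.vec k := scale_one _

theorem continuous_ev : Continuous fun q : T.Frame × (Fin n × ℂ) => q.1.ev q.2 := by
  have h : Continuous fun q : Fin n × T.Frame => q.2.vec q.1 :=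
    continuous_prod_of_discrete_left.2 continuous_vec
  exact continuous_scale.comp ((continuous_snd.comp continuous_snd).prodMk
    (h.comp ((continuous_fst.comp continuous_snd).prodMk continuous_fst)))

/-- The projection of `c α(k)` determines `k`, and pairing with `α(k)` then recovers `c`. -/
theorem ev_injective (α : T.Frame) : Injective α.ev := by
  rintro ⟨k, c⟩ ⟨l, d⟩ h
  have hz : (α.ev (k, c)).proj = (α.ev (l, d)).proj := by rw [h]
  have hkl : k = l := α.proj_injective hz
  subst hkl
  have h1 := congrArg (pair (α.vec k)) h
  simp only [ev_mk, pair_scale_right, pair_self_of_norm (α.norm_vec k), mul_one] at h1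
  rw [h1]

theorem exists_ev_eq (α : T.Frame) {q : TotalSpace ℂ T.L} (h : T.s q.proj = α.base) :
    ∃ t, α.ev t = q := by
  obtain ⟨k, hk⟩ := α.exists_proj_eq h
  exact ⟨(k, pair (α.vec k) q), scale_pair hk (α.norm_vec k)⟩

/-- The frame `α g` with `(α g)(k) = λ_{σ(k)} α(σ(k))` for `g = λσ`. -/
def act (α : T.Frame) (g : UnitaryNormalizer n) : T.Frame where
  vec k := α.ev (g • (k, (1 : ℂ)))
  norm_vec k := by
    rw [g.smul_pair, ev_mk, norm_scale, mul_one, g.norm_mat_index, α.norm_vec, mul_one]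
  exists_bijOn := by
    have h : Set.BijOn g.index Set.univ Set.univ :=
      Set.bijOn_univ.2 (Finite.injective_iff_bijective.1 g.index_injective)
    exact ⟨α.base, α.bijOn.comp h⟩

theorem vec_act (α : T.Frame) (g : UnitaryNormalizer n) (k : Fin n) :
    (α.act g).vec k = scale (g.mat (g.index k) k) (α.vec (g.index k)) :=
  congrArg (fun c => scale c (α.vec (g.index k))) (mul_one _)

/-- This balance makes evaluation descend to the associated bundle, and it also gives the
associativity of the action on frames. -/
theorem ev_act (α : T.Frame) (g : UnitaryNormalizer n) (t : Fin n × ℂ) :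
    (α.act g).ev t = α.ev (g • t) := by
  obtain ⟨k, c⟩ := t
  rw [ev_mk, vec_act, scale_scale, g.smul_pair, ev_mk, mul_comm]

instance : MulAction (UnitaryNormalizer n)ᵐᵒᵖ T.Frame where
  smul g α := α.act g.unop
  one_smul α := Frame.ext (funext fun k => by
    change α.ev ((1 : UnitaryNormalizer n) • (k, (1 : ℂ))) = _
    rw [one_smul, ev_one])
  mul_smul g h α := Frame.ext (funext fun k => by
    change α.ev ((h.unop * g.unop) • (k, (1 : ℂ))) = (α.act h.unop).ev (g.unop • (k, (1 : ℂ)))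
    rw [ev_act, mul_smul])

theorem vec_smul (α : T.Frame) (g : UnitaryNormalizer n) (k : Fin n) :
    (α <• g).vec k = scale (g.mat (g.index k) k) (α.vec (g.index k)) := α.vec_act g k

theorem ev_smul (α : T.Frame) (g : UnitaryNormalizer n) (t : Fin n × ℂ) :
    (α <• g).ev t = α.ev (g • t) := α.ev_act g t

theorem base_smul (α : T.Frame) (g : UnitaryNormalizer n) : (α <• g).base = α.base :=
  base_eq fun k => by rw [vec_smul, proj_scale, s_proj]

instance : ContinuousSMul (UnitaryNormalizer n)ᵐᵒᵖ T.Frame where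
  continuous_smul := by
    rw [isInducing_vec.continuous_iff, continuous_pi_iff]
    intro k
    have hg : Continuous fun q : (UnitaryNormalizer n)ᵐᵒᵖ × T.Frame => q.1.unop :=
      MulOpposite.continuous_unop.comp continuous_fst
    have h : Continuous fun q : (UnitaryNormalizer n)ᵐᵒᵖ × T.Frame =>
        q.2.ev (q.1.unop.index k, q.1.unop.mat (q.1.unop.index k) k) :=
      continuous_ev.comp (continuous_snd.prodMk
        (((UnitaryNormalizer.continuous_index k).comp hg).prodMk
          ((UnitaryNormalizer.continuous_mat_index k).comp hg)))
    exact h.congr fun q => (q.2.vec_smul q.1.unop k).symm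

/-- Vectors of `α` with different indices lie over different points, so pairing `α(l)` with a
multiple of `α(σ(k))` detects exactly one matrix entry. Freeness of the action and continuity of the
translation function both rest on this formula. -/
theorem mat_eq_pair {α β : T.Frame} {g : UnitaryNormalizer n} (h : α <• g = β) (l k : Fin n) :
    g.mat l k = pair (α.vec l) (β.vec k) := by
  rw [← h, vec_smul, pair_scale_right]
  by_cases hl : l = g.index k
  · rw [← hl, pair_self_of_norm (α.norm_vec l), mul_one]
  · rw [g.mat_eq_zero hl, pair_of_ne fun h => hl (α.proj_injective h), mul_zero]

theorem smul_right_injective (α : T.Frame) : Injective fun g : UnitaryNormalizer n => α <• g :=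
  fun g h hgh => UnitaryNormalizer.mat_injective (Matrix.ext fun l k => by
    rw [mat_eq_pair (α := α) rfl, mat_eq_pair (α := α) (g := h) rfl]
    exact congrArg (fun β : T.Frame => pair (α.vec l) (β.vec k)) hgh)

/-- The two enumerations of the fibre differ by a permutation `σ`, and the unit vectors `α(σ(k))`
and `β(k)` of one line differ by the phase `pair (α.vec (σ k)) (β.vec k)`. -/
theorem exists_smul_eq {α β : T.Frame} (h : α.base = β.base) :
    ∃ g : UnitaryNormalizer n, α <• g = β := by
  have h1 : ∀ k, ∃ l, (α.vec l).proj = (β.vec k).proj := fun k =>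
    α.exists_proj_eq ((β.s_proj k).trans h.symm)
  choose σ hσ using h1
  have hinj : Injective σ := fun j k hjk =>
    β.proj_injective ((hσ j).symm.trans (hjk ▸ hσ k))
  obtain ⟨g, hg⟩ := UnitaryNormalizer.exists_mat_eq_monomial
    (Equiv.ofBijective σ (Finite.injective_iff_bijective.1 hinj))
    (fun k => pair (α.vec (σ k)) (β.vec k)) fun k => by
      rw [norm_pair (hσ k) (α.norm_vec _), β.norm_vec]
  have hc : ∀ k, g.mat (σ k) k = pair (α.vec (σ k)) (β.vec k) := fun k => by
    rw [hg]
    exact if_pos rfl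
  refine ⟨g, Frame.ext (funext fun k => ?_)⟩
  -- The index is the row of the nonzero entry; the entry in row `σ k` is a phase, hence not zero.
  have hk : g.index k = σ k := g.index_eq fun h0 => by
    have h2 := norm_pair (hσ k) (α.norm_vec _)
    rw [← hc, h0, norm_zero, β.norm_vec] at h2
    exact zero_ne_one h2
  rw [vec_smul, hk, hc, scale_pair (hσ k) (α.norm_vec _)]

open Classical in
/-- The element `g` with `α g = β`, for frames `α` and `β` over the same point. -/
def translation (α β : T.Frame) : UnitaryNormalizer n :=
  if h : α.base = β.base then (exists_smul_eq h).choose else 1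

theorem smul_translation {α β : T.Frame} (h : α.base = β.base) : α <• translation α β = β := by
  rw [translation, dif_pos h]
  exact (exists_smul_eq h).choose_spec

theorem translation_smul (α : T.Frame) (g : UnitaryNormalizer n) :
    translation α (α <• g) = g :=
  α.smul_right_injective (smul_translation (α.base_smul g).symm)

/-- The entries of the matrix are pairings of vectors over a common point of `X`. -/
theorem continuousOn_translation : ContinuousOn (fun q : T.Frame × T.Frame => translation q.1 q.2)
    {q | q.1.base = q.2.base} := by
  rw [UnitaryNormalizer.isInducing_mat.continuousOn_iff]
  refine continuousOn_pi.2 fun l => continuousOn_pi.2 fun k => ?_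
  have h : ContinuousOn (fun q : T.Frame × T.Frame => pair (q.1.vec l) (q.2.vec k))
      {q | q.1.base = q.2.base} :=
    T.continuousOn_pair.comp (((continuous_vec l).comp continuous_fst).prodMk
      ((continuous_vec k).comp continuous_snd)).continuousOn fun q hq => by
        change T.s (q.1.vec l).proj = T.s (q.2.vec k).proj
        rw [s_proj, s_proj, hq]
  exact h.congr fun q hq => mat_eq_pair (smul_translation hq) l k

end Frame

/-- Locally there are continuous sections `σ₁, …, σₙ` of `s` which enumerate the fibres. -/
theorem exists_local_enumeration (x : X) : ∃ (U : Set X) (σ : Fin n → X → T.Z), IsOpen U ∧ x ∈ U ∧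
    (∀ k, ContinuousOn (σ k) U) ∧
    ∀ y ∈ U, Set.BijOn (fun k => σ k y) Set.univ (T.s ⁻¹' {y}) := by
  have hev := T.isCoveringMap x
  have hne : Nonempty (T.s ⁻¹' {x}) := by
    obtain ⟨z, hz⟩ := T.surjective x
    exact ⟨⟨z, hz⟩⟩
  have hfin : Finite (T.s ⁻¹' {x}) := T.finite_fiber x
  have hcard : Nat.card (T.s ⁻¹' {x}) = n := by
    rw [Nat.card_coe_set_eq, Set.ncard_def, T.encard_fiber]
    rfl
  let ι : Fin n ≃ T.s ⁻¹' {x} := (Finite.equivFinOfCardEq hcard).symm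
  set t := hev.toTrivialization
  refine ⟨t.baseSet, fun k y => t.toOpenPartialHomeomorph.symm (y, ι k), t.open_baseSet,
    hev.mem_toTrivialization_baseSet, fun k => t.continuousOn_symm_prodMk_left,
    fun y hy => ⟨fun k _ => t.proj_symm_apply' hy, fun j _ k _ hjk => ?_, fun z hz => ?_⟩⟩
  · have h := congrArg t hjk
    simp only [t.apply_symm_apply' hy] at h
    exact ι.injective (Prod.ext_iff.1 h).2
  · have hz' : T.s z = y := hz
    subst hz'
    refine ⟨ι.symm (t z).2, Set.mem_univ _, ?_⟩
    simp only [ι.apply_symm_apply]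
    exact t.symm_apply_mk_proj (t.mem_source.2 hy)

/-- The frames have continuous local sections. -/
theorem exists_local_frame (x : X) : ∃ (U : Set X) (b : X → T.Frame), IsOpen U ∧ x ∈ U ∧
    ContinuousOn b U ∧ ∀ y ∈ U, (b y).base = y := by
  obtain ⟨U, σ, hU, hx, hσ, hbij⟩ := T.exists_local_enumeration x
  choose V ω hV hmem hω hunit using fun k => exists_local_unit_section (E := T.L) (σ k x)
  -- The `σ k` are continuous only on `U`, so the preimages of the `V k` are known to be open only
  -- after intersection with `U`.
  let W : Set X := ⋂ k, U ∩ (U ∩ σ k ⁻¹' V k)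
  have hWU : U ∩ W ⊆ U := Set.inter_subset_left
  have hWV : ∀ k, ∀ y ∈ U ∩ W, σ k y ∈ V k := fun k y hy => (Set.mem_iInter.1 hy.2 k).2.2
  have hW : IsOpen (U ∩ W) := hU.inter (isOpen_iInter_of_finite fun k =>
    hU.inter ((hσ k).isOpen_inter_preimage hU (hV k)))
  have hxW : x ∈ U ∩ W := ⟨hx, Set.mem_iInter.2 fun k => ⟨hx, hx, hmem k⟩⟩
  have key : ∀ y ∈ U ∩ W, ∃ α : T.Frame, α.vec = fun k => ω k (σ k y) := fun y hy =>
    ⟨⟨fun k => ω k (σ k y), fun k => (hunit k _ (hWV k y hy)).2, y,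
      (hbij y hy.1).congr fun k _ => (hunit k _ (hWV k y hy)).1.symm⟩, rfl⟩
  -- The local section is chosen as a function on all of `X`; outside the neighbourhood its value is
  -- an arbitrary frame, namely one over `x`.
  have key' : ∀ y, ∃ α : T.Frame, y ∈ U ∩ W → α.vec = fun k => ω k (σ k y) := fun y => by
    by_cases hy : y ∈ U ∩ W
    · obtain ⟨α, hα⟩ := key y hy
      exact ⟨α, fun _ => hα⟩
    · obtain ⟨α, -⟩ := key x hxW
      exact ⟨α, fun h => absurd h hy⟩
  choose b hb using key'
  refine ⟨U ∩ W, b, hW, hxW, ?_, fun y hy => Frame.base_eq fun k => ?_⟩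
  · rw [Frame.isInducing_vec.continuousOn_iff]
    refine continuousOn_pi.2 fun k => ?_
    refine ((hω k).comp ((hσ k).mono hWU) (hWV k)).congr fun y hy => ?_
    exact congrFun (hb y hy) k
  · rw [hb y hy, (hunit k _ (hWV k y hy)).1]
    exact (hbij y hy.1).mapsTo (Set.mem_univ k)

/-- The local trivialization of the frames given by a local section. -/
def frameTriv {U : Set X} {b : X → T.Frame} (hU : IsOpen U) (hb : ContinuousOn b U)
    (hbase : ∀ y ∈ U, (b y).base = y) :
    Trivialization (UnitaryNormalizer n) (Frame.base : T.Frame → X) where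
  toFun α := (α.base, Frame.translation (b α.base) α)
  invFun y := b y.1 <• y.2
  source := Frame.base ⁻¹' U
  target := U ×ˢ Set.univ
  map_source' α hα := ⟨hα, Set.mem_univ _⟩
  map_target' y hy := by
    change (b y.1 <• y.2).base ∈ U
    rw [Frame.base_smul, hbase _ hy.1]
    exact hy.1
  left_inv' α hα := Frame.smul_translation (hbase _ hα)
  right_inv' y hy := by
    have h : (b y.1 <• y.2).base = y.1 := by rw [Frame.base_smul, hbase _ hy.1]
    refine Prod.ext h ?_
    change Frame.translation (b (b y.1 <• y.2).base) (b y.1 <• y.2) = y.2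
    rw [h, Frame.translation_smul]
  open_source := hU.preimage Frame.continuous_base
  open_target := hU.prod isOpen_univ
  continuousOn_toFun := by
    refine Frame.continuous_base.continuousOn.prodMk ?_
    exact Frame.continuousOn_translation.comp
      ((hb.comp Frame.continuous_base.continuousOn fun _ h => h).prodMk continuousOn_id)
      fun α hα => hbase _ hα
  continuousOn_invFun := by
    have h : ContinuousOn (fun y : X × UnitaryNormalizer n => (MulOpposite.op y.2, b y.1))
        (U ×ˢ Set.univ) :=
      (MulOpposite.continuous_op.comp continuous_snd).continuousOn.prodMk
        (hb.comp continuousOn_fst fun y hy => hy.1)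
    exact continuous_smul.comp_continuousOn h
  baseSet := U
  open_baseSet := hU
  source_eq := rfl
  target_eq := rfl
  proj_toFun _ _ := rfl

/-- The principal bundle of the frames of a twisted covering. -/
def frameBundle : PrincipalBundle.{u, 0, max v w} (UnitaryNormalizer n) X where
  carrier := T.Frame
  proj := Frame.base
  continuous_proj := Frame.continuous_base
  proj_act := Frame.base_smul
  exists_chart x := by
    obtain ⟨U, b, hU, hx, hb, hbase⟩ := T.exists_local_frame x
    refine ⟨T.frameTriv hU hb hbase, hx, fun α hα g => ?_⟩
    change Frame.translation (b (α <• g).base) (α <• g) = Frame.translation (b α.base) α * g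
    rw [Frame.base_smul]
    -- By freeness it suffices that both group elements carry the local section to `α g`.
    apply (b α.base).smul_right_injective
    change b α.base <• _ = b α.base <• _
    rw [Frame.smul_translation ((hbase _ hα).trans (α.base_smul g).symm), ← op_smul_op_smul,
      Frame.smul_translation (hbase _ hα)]

/-- The bundle of frames corresponds to the twisted covering. -/
theorem nonempty_correspondence_frameBundle : Nonempty (Correspondence T.frameBundle T) := by
  let f : T.frameBundle.Assoc (Fin n × ℂ) → TotalSpace ℂ T.L :=
    Quotient.lift (fun q => Frame.ev q.1 q.2) (by
      rintro ⟨α, t⟩ _ ⟨g, rfl⟩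
      exact ((Frame.ev_act α g (g⁻¹ • t)).trans
        (congrArg (Frame.ev α) (smul_inv_smul g t))).symm)
  have hf : Continuous f := Frame.continuous_ev.quotient_lift _
  have hbij : Bijective f := by
    constructor
    · intro a a' h
      induction a using PrincipalBundle.Assoc.ind with
      | h α t =>
      induction a' using PrincipalBundle.Assoc.ind with
      | h β t' =>
      have hb : T.frameBundle.proj α = T.frameBundle.proj β :=
        (Frame.s_proj_ev α t).symm.trans ((congrArg (fun q : TotalSpace ℂ T.L => T.s q.proj) h).trans
          (Frame.s_proj_ev β t'))
      obtain ⟨g, rfl⟩ := PrincipalBundle.exists_act hb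
      rw [PrincipalBundle.Assoc.mk_act]
      exact congrArg _ (Frame.ev_injective α (h.trans (Frame.ev_act α g t')))
    · intro q
      obtain ⟨U, b, -, hx, -, hbase⟩ := T.exists_local_frame (T.s q.proj)
      obtain ⟨t, ht⟩ := (b _).exists_ev_eq (hbase _ hx).symm
      exact ⟨PrincipalBundle.Assoc.mk (P := T.frameBundle) (b _) t, ht⟩
  have hinv : Continuous (Equiv.ofBijective f hbij).symm := by
    rw [continuous_iff_continuousAt]
    intro q
    have hs : Continuous fun r : TotalSpace ℂ T.L => T.s r.proj :=
      T.isCoveringMap.continuous.comp (FiberBundle.continuous_proj ℂ T.L)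
    -- Near `q` the inverse is `r ↦ [b, (k, ⟨b(k), r⟩)]` with the local frame `b` at the point of
    -- `X` below `r` and a fixed index `k`. The index chosen at `q` works nearby, because the
    -- projections of `b(k)` and of `r` are two lifts of the same map to `X` that agree at `q`.
    obtain ⟨U, b, hU, hx, hb, hbase⟩ := T.exists_local_frame (T.s q.proj)
    obtain ⟨k, hk⟩ := (b _).exists_proj_eq (hbase _ hx).symm
    have hev : ∀ᶠ r in 𝓝 q, T.s r.proj ∈ U := hs.continuousAt (hU.mem_nhds hx)
    have hbc : ContinuousAt (fun r : TotalSpace ℂ T.L => b (T.s r.proj)) q :=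
      (hb.continuousAt (hU.mem_nhds hx)).comp (f := fun r : TotalSpace ℂ T.L => T.s r.proj)
        hs.continuousAt
    have hvc : ContinuousAt (fun r : TotalSpace ℂ T.L => (b (T.s r.proj)).vec k) q :=
      (Frame.continuous_vec k).continuousAt.comp hbc
    have hfst : ∀ᶠ r in 𝓝 q, ((b (T.s r.proj)).vec k).proj = r.proj := by
      refine T.eventuallyEq_of_lift (z := q.proj) ?_
        (FiberBundle.continuous_proj ℂ T.L).continuousAt ?_
      · have h := (FiberBundle.continuous_proj ℂ T.L).continuousAt.comp hvc
        have h' := h.tendsto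
        simp only [Function.comp_apply, hk] at h'
        exact h'
      · filter_upwards [hev] with r hr
        rw [Frame.s_proj, hbase _ hr]
    have hpair : ContinuousAt (fun r : TotalSpace ℂ T.L => pair ((b (T.s r.proj)).vec k) r) q := by
      have h1 : ContinuousWithinAt (fun p : TotalSpace ℂ T.L × TotalSpace ℂ T.L => pair p.1 p.2)
          {p | T.s p.1.proj = T.s p.2.proj} ((b (T.s q.proj)).vec k, q) :=
        T.continuousOn_pair _ (congrArg T.s hk)
      refine h1.tendsto.comp (tendsto_nhdsWithin_iff.2 ⟨hvc.prodMk continuousAt_id, ?_⟩)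
      filter_upwards [hfst] with r hr
      exact congrArg T.s hr
    have hmkc : ContinuousAt (fun r : TotalSpace ℂ T.L => PrincipalBundle.Assoc.mk
        (P := T.frameBundle) (b (T.s r.proj)) (k, pair ((b (T.s r.proj)).vec k) r)) q :=
      (PrincipalBundle.Assoc.continuous_mk (P := T.frameBundle)
        (F := Fin n × ℂ)).continuousAt.comp
          (f := fun r : TotalSpace ℂ T.L => ((b (T.s r.proj) : T.frameBundle.carrier),
            (k, pair ((b (T.s r.proj)).vec k) r)))
          (hbc.prodMk (continuousAt_const.prodMk hpair))
    refine hmkc.congr ?_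
    filter_upwards [hfst] with r hr
    rw [Equiv.eq_symm_apply]
    exact scale_pair hr (Frame.norm_vec _ k)
  refine ⟨⟨⟨Equiv.ofBijective f hbij, hf, hinv⟩, fun a => ?_, fun α k => ?_⟩⟩
  · induction a using PrincipalBundle.Assoc.ind with
    | h α t => exact Frame.s_proj_ev α t
  · have hα : ‖(Frame.vec α k).2‖ = 1 := Frame.norm_vec α k
    -- The map `c ↦ c α(k)` is isometric as `α(k)` is a unit vector, and onto as the fibre is a
    -- line.
    refine ⟨(Frame.vec α k).proj, LinearIsometryEquiv.ofSurjective
      (LinearIsometry.toSpanSingleton ℂ _ hα) fun a => ?_, fun c => rfl⟩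
    exact ⟨inner ℂ (Frame.vec α k).2 a, inner_smul_of_norm hα a⟩

end TwistedCovering

/-! ### Equivariant maps between principal bundles -/

namespace PrincipalBundle

universe q

variable {G : Type w} [Group G] [TopologicalSpace G] {X : Type u} [TopologicalSpace X]
  {P : PrincipalBundle.{u, w, p} G X} {P' : PrincipalBundle.{u, w, q} G X}

/-- Fibres of both bundles over a point are torsors under `G`, and an equivariant map between
torsors is bijective. -/
theorem bijective_of_equivariant {F : P.carrier → P'.carrier}
    (hproj : ∀ α, P'.proj (F α) = P.proj α) (hact : ∀ (α) (g : G), F (α <• g) = F α <• g) :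
    Bijective F := by
  constructor
  · intro α β h
    obtain ⟨g, rfl⟩ := exists_act (P := P) (α := α) (β := β) (by rw [← hproj, h, hproj])
    rw [hact] at h
    rw [act_eq_self h.symm]
    exact (one_smul _ α).symm
  · intro β
    obtain ⟨α, hα⟩ := P.surjective_proj (P'.proj β)
    obtain ⟨g, hg⟩ := exists_act (P := P') (α := F α) (β := β) (by rw [hproj, hα])
    exact ⟨α <• g, by rw [hact, hg]⟩

/-- A continuous equivariant base-preserving map between principal bundles is a homeomorphism. -/
def homeomorphOfEquivariant [IsTopologicalGroup G] (F : P.carrier → P'.carrier)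
    (hF : Continuous F) (hproj : ∀ α, P'.proj (F α) = P.proj α)
    (hact : ∀ (α) (g : G), F (α <• g) = F α <• g) : P.carrier ≃ₜ P'.carrier where
  toEquiv := Equiv.ofBijective F (bijective_of_equivariant hproj hact)
  continuous_toFun := hF
  continuous_invFun := by
    rw [continuous_iff_continuousAt]
    intro β
    set e := P.chartAt (P'.proj β)
    set e' := P'.chartAt (P'.proj β)
    have he : P'.proj β ∈ e.triv.baseSet := P.mem_chartAt _
    have he' : P'.proj β ∈ e'.triv.baseSet := P'.mem_chartAt _
    have hb : ∀ᶠ γ in 𝓝 β, P'.proj γ ∈ e.triv.baseSet ∩ e'.triv.baseSet :=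
      P'.continuous_proj.continuousAt ((e.triv.open_baseSet.inter e'.triv.open_baseSet).mem_nhds
        ⟨he, he'⟩)
    have hsec : ContinuousAt (fun γ => e.sec (P'.proj γ)) β :=
      (e.continuousOn_sec.continuousAt (e.triv.open_baseSet.mem_nhds he)).comp
        P'.continuous_proj.continuousAt
    have h1 : ContinuousAt (fun γ => (e'.triv (F (e.sec (P'.proj γ)))).2) β := by
      refine continuousAt_snd.comp (ContinuousAt.comp (g := e'.triv) ?_
        (hF.continuousAt.comp hsec))
      refine e'.triv.continuousAt (e'.mem_source.2 ?_)
      rw [hproj, e.proj_sec he]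
      exact he'
    have h2 : ContinuousAt (fun γ => (e'.triv γ).2) β :=
      continuousAt_snd.comp (e'.triv.continuousAt (e'.mem_source.2 he'))
    -- In charts `F` is `(x, g) ↦ (x, h(x) g)`, where `h(x)` is the coordinate of the image of the
    -- local section; the inverse is left multiplication by `h(x)⁻¹`, continuous because inversion
    -- in `G` is.
    have h3 : ContinuousAt (fun γ => MulOpposite.op
        ((e'.triv (F (e.sec (P'.proj γ)))).2⁻¹ * (e'.triv γ).2) • e.sec (P'.proj γ)) β :=
      (MulOpposite.continuous_op.continuousAt.comp (h1.inv.mul h2)).smul hsec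
    refine h3.congr ?_
    filter_upwards [hb] with γ hγ
    refine ((Equiv.ofBijective F (bijective_of_equivariant hproj hact)).eq_symm_apply).2 ?_
    change F (e.sec (P'.proj γ) <• _) = γ
    have hs : P'.proj (F (e.sec (P'.proj γ))) = P'.proj γ := by rw [hproj, e.proj_sec hγ.1]
    have h4 := e'.sec_act (α := F (e.sec (P'.proj γ))) (by rw [hs]; exact hγ.2)
    rw [hs] at h4
    rw [hact, ← h4, op_smul_op_smul, h4, mul_inv_cancel_left, e'.sec_act hγ.2]

end PrincipalBundle

/-! ### The frames given by a correspondence -/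

namespace Correspondence

variable {X : Type u} [TopologicalSpace X] {n : ℕ}
  {P : PrincipalBundle.{u, 0, p} (UnitaryNormalizer n) X} {T : TwistedCovering.{u, v, w} X n}
  (θ : Correspondence P T)

/-- By linearity on fibres, `θ` is determined by its values at `c = 1`. -/
theorem apply_mk (α : P.carrier) (k : Fin n) (c : ℂ) :
    θ.toHomeomorph (PrincipalBundle.Assoc.mk α (k, c)) =
      scale c (θ.toHomeomorph (PrincipalBundle.Assoc.mk α (k, 1))) := by
  obtain ⟨z, φ, h⟩ := θ.exists_isometry α k
  rw [h, h, scale_mk, ← map_smul, smul_eq_mul, mul_one]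

/-- The frame `k ↦ θ[α, (k, 1)]`. -/
def frame (α : P.carrier) : T.Frame where
  vec k := θ.toHomeomorph (PrincipalBundle.Assoc.mk α (k, 1))
  norm_vec k := by
    obtain ⟨z, φ, h⟩ := θ.exists_isometry α k
    rw [h]
    exact (φ.norm_map 1).trans norm_one
  exists_bijOn := by
    refine ⟨P.proj α, fun k _ => θ.s_proj _, fun k _ l _ hkl => ?_, fun z hz => ?_⟩
    · simp only at hkl
      -- Vectors over the same point of `Z` have the same multiple by `0`. Injectivity of `θ` and
      -- freeness of the action then turn this into equality of the indices.
      have h : θ.toHomeomorph (PrincipalBundle.Assoc.mk α (k, 0)) =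
          θ.toHomeomorph (PrincipalBundle.Assoc.mk α (l, 0)) := by
        rw [θ.apply_mk α k, θ.apply_mk α l]
        generalize θ.toHomeomorph (PrincipalBundle.Assoc.mk α (k, 1)) = q at hkl ⊢
        generalize θ.toHomeomorph (PrincipalBundle.Assoc.mk α (l, 1)) = r at hkl ⊢
        obtain ⟨b, a⟩ := q
        obtain ⟨b', a'⟩ := r
        obtain rfl : b = b' := hkl
        rw [scale_mk, scale_mk, zero_smul, zero_smul]
      obtain ⟨g, h1, h2⟩ := PrincipalBundle.Assoc.mk_eq_mk.1 (θ.toHomeomorph.injective h)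
      rw [PrincipalBundle.act_eq_self h1.symm, inv_one, one_smul] at h2
      exact (congrArg Prod.fst h2).symm
    -- Any preimage of a point over `z` has a representative with first entry `α`, and its index is
    -- the one sought.
    · obtain ⟨a, ha⟩ := θ.toHomeomorph.surjective ⟨z, 0⟩
      have hs := θ.s_proj a
      rw [ha] at hs
      induction a using PrincipalBundle.Assoc.ind with
      | h β t =>
      obtain ⟨g, rfl⟩ := PrincipalBundle.exists_act (P := P) (α := α) (β := β) (hz.symm.trans hs)
      rw [PrincipalBundle.Assoc.mk_act] at ha
      generalize g • t = t' at ha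
      obtain ⟨k, c⟩ := t'
      rw [θ.apply_mk] at ha
      exact ⟨k, Set.mem_univ _, congrArg (fun q : TotalSpace ℂ T.L => q.proj) ha⟩

theorem ev_frame (α : P.carrier) (t : Fin n × ℂ) :
    (θ.frame α).ev t = θ.toHomeomorph (PrincipalBundle.Assoc.mk α t) := (θ.apply_mk α t.1 t.2).symm

theorem base_frame (α : P.carrier) : (θ.frame α).base = P.proj α :=
  TwistedCovering.Frame.base_eq fun _ => θ.s_proj _

theorem frame_act (α : P.carrier) (g : UnitaryNormalizer n) :
    θ.frame (α <• g) = θ.frame α <• g :=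
  TwistedCovering.Frame.ext (funext fun k => by
    rw [← TwistedCovering.Frame.ev_one, ← TwistedCovering.Frame.ev_one,
      TwistedCovering.Frame.ev_smul, ev_frame, ev_frame, PrincipalBundle.Assoc.mk_act])

theorem continuous_frame : Continuous θ.frame := by
  rw [TwistedCovering.Frame.isInducing_vec.continuous_iff, continuous_pi_iff]
  intro k
  exact θ.toHomeomorph.continuous.comp (PrincipalBundle.Assoc.continuous_mk.comp
    (continuous_id.prodMk continuous_const))

/-- The identification of a bundle that corresponds to `(Z, s, L)` with the bundle of frames. -/
def frameHomeomorph : P.carrier ≃ₜ T.Frame :=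
  PrincipalBundle.homeomorphOfEquivariant (P' := T.frameBundle) θ.frame θ.continuous_frame
    θ.base_frame θ.frame_act

end Correspondence

/-! ### Action of isomorphisms of twisted coverings on frames -/

namespace TwistedCovering

variable {X : Type u} [TopologicalSpace X] {n : ℕ} {T T' : TwistedCovering.{u, v, w} X n}

theorem Iso.total_eq_scale (e : T.Iso T') (c : ℂ) (q : TotalSpace ℂ T.L) :
    e.total (scale c q) = scale c (e.total q) := by
  obtain ⟨z, a⟩ := q
  rw [scale_mk, e.total_mk, e.total_mk, scale_mk, map_smul]

theorem Iso.proj_total (e : T.Iso T') (q : TotalSpace ℂ T.L) :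
    (e.total q).proj = e.base q.proj := by
  obtain ⟨z, a⟩ := q
  rw [e.total_mk]

/-- The map between the frames induced by an isomorphism of twisted coverings. -/
def Iso.frameMap (e : T.Iso T') (α : T.Frame) : T'.Frame where
  vec k := e.total (α.vec k)
  norm_vec k := by
    have h := e.total_mk (α.vec k).1 (α.vec k).2
    change e.total (α.vec k) = _ at h
    rw [h, LinearIsometryEquiv.norm_map, α.norm_vec]
  exists_bijOn := by
    refine ⟨α.base, fun k _ => ?_, fun k _ l _ hkl => ?_, fun z' hz' => ?_⟩
    · change T'.s (e.total (α.vec k)).proj = α.base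
      rw [e.proj_total, e.s_base, α.s_proj]
    · simp only [e.proj_total] at hkl
      exact α.proj_injective (e.base.injective hkl)
    · obtain ⟨z, rfl⟩ := e.base.surjective z'
      obtain ⟨k, hk⟩ := α.exists_proj_eq ((e.s_base z).symm.trans hz')
      refine ⟨k, Set.mem_univ _, ?_⟩
      change (e.total (α.vec k)).proj = _
      rw [e.proj_total, hk]

theorem Iso.vec_frameMap (e : T.Iso T') (α : T.Frame) (k : Fin n) :
    (e.frameMap α).vec k = e.total (α.vec k) := rfl

theorem Iso.continuous_frameMap (e : T.Iso T') : Continuous e.frameMap := by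
  rw [Frame.isInducing_vec.continuous_iff, continuous_pi_iff]
  exact fun k => e.total.continuous.comp (Frame.continuous_vec k)

theorem Iso.base_frameMap (e : T.Iso T') (α : T.Frame) : (e.frameMap α).base = α.base :=
  Frame.base_eq fun k => by rw [e.vec_frameMap, e.proj_total, e.s_base, α.s_proj]

theorem Iso.frameMap_smul (e : T.Iso T') (α : T.Frame) (g : UnitaryNormalizer n) :
    e.frameMap (α <• g) = e.frameMap α <• g :=
  Frame.ext (funext fun k => by
    rw [e.vec_frameMap, Frame.vec_smul, Frame.vec_smul, e.total_eq_scale, e.vec_frameMap])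

end TwistedCovering

/-! ### The induced isomorphism of principal bundles -/

namespace Correspondence

variable {X : Type u} [TopologicalSpace X] {n : ℕ}
  {P P' : PrincipalBundle.{u, 0, p} (UnitaryNormalizer n) X}
  {T T' : TwistedCovering.{u, v, w} X n}

theorem continuous_inducedIso (θ : Correspondence P T) (θ' : Correspondence P' T') (e : T.Iso T') :
    Continuous fun α => θ'.frameHomeomorph.symm (e.frameMap (θ.frame α)) :=
  θ'.frameHomeomorph.symm.continuous.comp (e.continuous_frameMap.comp θ.continuous_frame)

theorem frame_frameHomeomorph_symm (θ : Correspondence P T) (β : T.Frame) :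
    θ.frame (θ.frameHomeomorph.symm β) = β := θ.frameHomeomorph.apply_symm_apply β

theorem frame_injective (θ : Correspondence P T) : Injective θ.frame :=
  θ.frameHomeomorph.injective

/-- The isomorphism of principal bundles induced by an isomorphism of twisted coverings. -/
def inducedIso (θ : Correspondence P T) (θ' : Correspondence P' T') (e : T.Iso T') : P.Iso P' :=
  have hproj : ∀ α, P'.proj (θ'.frameHomeomorph.symm (e.frameMap (θ.frame α))) = P.proj α :=
    fun α => by
      rw [← θ'.base_frame, frame_frameHomeomorph_symm, e.base_frameMap, θ.base_frame]
  have hact : ∀ (α) (g : UnitaryNormalizer n),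
      θ'.frameHomeomorph.symm (e.frameMap (θ.frame (α <• g))) =
        θ'.frameHomeomorph.symm (e.frameMap (θ.frame α)) <• g := fun α g => by
    apply θ'.frame_injective
    rw [θ'.frame_act, frame_frameHomeomorph_symm, frame_frameHomeomorph_symm, θ.frame_act,
      e.frameMap_smul]
  { toHomeomorph := PrincipalBundle.homeomorphOfEquivariant _ (continuous_inducedIso θ θ' e)
      hproj hact
    proj_map := hproj
    map_act := hact }

theorem frame_inducedIso (θ : Correspondence P T) (θ' : Correspondence P' T') (e : T.Iso T')
    (α : P.carrier) :
    θ'.frame ((inducedIso θ θ' e).toHomeomorph α) = e.frameMap (θ.frame α) :=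
  θ'.frame_frameHomeomorph_symm _

/-- Both sides of the defining equation are linear in `c`, so testing at the points `(k, 1)`
suffices. The resulting equation of frames determines `f`, since `θ'.frame` is injective. -/
theorem isInducedBy_iff (θ : Correspondence P T) (θ' : Correspondence P' T') (e : T.Iso T')
    (f : P.Iso P') : IsInducedBy f θ θ' e ↔
      ∀ α, θ'.frame (f.toHomeomorph α) = e.frameMap (θ.frame α) := by
  constructor
  · intro h α
    exact TwistedCovering.Frame.ext (funext fun k => h (PrincipalBundle.Assoc.mk α (k, 1)))
  · intro h a
    induction a using PrincipalBundle.Assoc.ind with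
    | h α t =>
    obtain ⟨k, c⟩ := t
    rw [PrincipalBundle.Iso.assocMap_mk, ← ev_frame, ← ev_frame, h, TwistedCovering.Frame.ev_mk,
      TwistedCovering.Frame.ev_mk, e.vec_frameMap, e.total_eq_scale]

theorem eq_inducedIso (θ : Correspondence P T) (θ' : Correspondence P' T') (e : T.Iso T')
    {f : P.Iso P'} (h : IsInducedBy f θ θ' e) : f = inducedIso θ θ' e := by
  rw [isInducedBy_iff] at h
  refine PrincipalBundle.Iso.ext (Homeomorph.ext fun α => θ'.frame_injective ?_)
  rw [h, frame_inducedIso]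

end Correspondence

/-! ### The isomorphism of Hilbert modules -/

namespace TwistedCovering.Frame

open Matrix

variable {X : Type u} [TopologicalSpace X] {n : ℕ} {T : TwistedCovering.{u, v, w} X n}

open Classical in
/-- The vector in the fibre over `z` with coordinate `v` in the frame `α`: it is `v(k) α(k)` if
`α(k)` lies over `z`. -/
def comb (α : T.Frame) (v : EuclideanSpace ℂ (Fin n)) (z : T.Z) : T.L z :=
  if h : ∃ k, (α.vec k).proj = z then v h.choose • (h.choose_spec ▸ (α.vec h.choose).2) else 0

theorem comb_proj (α : T.Frame) (v : EuclideanSpace ℂ (Fin n)) (k : Fin n) :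
    α.comb v (α.vec k).proj = v k • (α.vec k).2 := by
  have h : ∃ l, (α.vec l).proj = (α.vec k).proj := ⟨k, rfl⟩
  rw [comb, dif_pos h]
  -- The index chosen in `comb` can only be `k`; it is made a variable so that the transport along
  -- the equality of points disappears.
  have key : ∀ (l : Fin n) (hl : (α.vec l).proj = (α.vec k).proj),
      (v l • (hl ▸ (α.vec l).2) : T.L (α.vec k).proj) = v k • (α.vec k).2 := by
    intro l hl
    obtain rfl := α.proj_injective hl
    rfl
  exact key _ h.choose_spec

theorem mk_comb (α : T.Frame) (v : EuclideanSpace ℂ (Fin n)) {z : T.Z} {k : Fin n}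
    (h : (α.vec k).proj = z) : TotalSpace.mk' ℂ z (α.comb v z) = scale (v k) (α.vec k) := by
  subst h
  rw [comb_proj]
  rfl

theorem comb_add (α : T.Frame) (v v' : EuclideanSpace ℂ (Fin n)) {z : T.Z} (hz : T.s z = α.base) :
    α.comb (v + v') z = α.comb v z + α.comb v' z := by
  obtain ⟨k, rfl⟩ := α.exists_proj_eq hz
  simp only [comb_proj, PiLp.add_apply, add_smul]

theorem comb_smul (α : T.Frame) (c : ℂ) (v : EuclideanSpace ℂ (Fin n)) {z : T.Z}
    (hz : T.s z = α.base) : α.comb (c • v) z = c • α.comb v z := by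
  obtain ⟨k, rfl⟩ := α.exists_proj_eq hz
  simp only [comb_proj, PiLp.smul_apply, smul_eq_mul, mul_smul]

theorem norm_comb_le (α : T.Frame) (v : EuclideanSpace ℂ (Fin n)) {z : T.Z}
    (hz : T.s z = α.base) : ‖α.comb v z‖ ≤ ‖v‖ := by
  obtain ⟨k, rfl⟩ := α.exists_proj_eq hz
  rw [comb_proj, norm_smul, α.norm_vec, mul_one]
  exact PiLp.norm_apply_le v k

/-- At the `k`-th point of `α g` both sides are the multiple of `α(σ(k))` by `g_{σ(k) k} v_k`: on
the left the entry belongs to the frame, on the right to the vector `g v`. This makes `toLine`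
independent of the representative. -/
theorem comb_act (α : T.Frame) (g : UnitaryNormalizer n) (v : EuclideanSpace ℂ (Fin n)) {z : T.Z}
    (hz : T.s z = α.base) : (α <• g).comb v z = α.comb (g • v) z := by
  obtain ⟨k, rfl⟩ := (α <• g).exists_proj_eq (hz.trans (α.base_smul g).symm)
  have hk : (α.vec (g.index k)).proj = ((α <• g).vec k).proj := by
    rw [vec_smul, proj_scale]
  apply TotalSpace.mk_injective (F := ℂ)
  refine (mk_comb _ _ rfl).trans ((mk_comb _ _ hk).trans ?_).symm
  rw [vec_smul, scale_scale, g.smul_vec, mul_comm]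
  exact congrArg (fun c => scale c _) (g.mulVec_index v.ofLp k)

/-- The coordinates of a section of `L` in the frame `α`. -/
def coeff (α : T.Frame) (t : ∀ z, T.L z) : EuclideanSpace ℂ (Fin n) :=
  WithLp.toLp 2 fun k => inner ℂ (α.vec k).2 (t (α.vec k).proj)

theorem comb_coeff (α : T.Frame) (t : ∀ z, T.L z) {z : T.Z} (hz : T.s z = α.base) :
    α.comb (α.coeff t) z = t z := by
  obtain ⟨k, rfl⟩ := α.exists_proj_eq hz
  rw [comb_proj]
  exact inner_smul_of_norm (α.norm_vec k) _

/-- Coordinates with respect to unit vectors are unique; only the values of `t` over the base point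
enter. -/
theorem coeff_eq (α : T.Frame) {t : ∀ z, T.L z} {v : EuclideanSpace ℂ (Fin n)}
    (h : ∀ z, T.s z = α.base → t z = α.comb v z) : α.coeff t = v := by
  ext k
  change inner ℂ (α.vec k).2 (t (α.vec k).proj) = v k
  rw [h _ (α.s_proj k), comb_proj, inner_smul_right, inner_self_eq_norm_sq_to_K, α.norm_vec]
  simp

theorem coeff_act (α : T.Frame) (g : UnitaryNormalizer n) (t : ∀ z, T.L z) :
    g • (α <• g).coeff t = α.coeff t :=
  (α.coeff_eq fun _ hz => by
    rw [← α.comb_act g _ hz, comb_coeff _ _ (hz.trans (α.base_smul g).symm)]).symm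

/-- The frame enumerates the fibre, and as its vectors have norm `1` the summands become those of
the inner product of `ℂⁿ`. -/
theorem finsum_inner_comb (α : T.Frame) (v v' : EuclideanSpace ℂ (Fin n)) :
    ∑ᶠ z ∈ T.s ⁻¹' {α.base}, inner ℂ (α.comb v z) (α.comb v' z) = inner ℂ v v' := by
  have h := finsum_mem_eq_of_bijOn (f := fun k => inner ℂ (v k) (v' k))
    (g := fun z => inner ℂ (α.comb v z) (α.comb v' z)) _ α.bijOn fun k _ => by
      rw [comb_proj, comb_proj, inner_smul_left, inner_smul_right, inner_self_eq_norm_sq_to_K,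
        α.norm_vec, RCLike.inner_apply]
      simp [mul_comm]
  rw [← h, finsum_mem_univ, finsum_eq_sum_of_fintype, PiLp.inner_apply]

/-- As `e` is linear on fibres, it takes `v_k α(k)` to `v_k e(α(k))`. This is what naturality
amounts to. -/
theorem comb_frameMap {T' : TwistedCovering.{u, v, w} X n} (e : T.Iso T') (α : T.Frame)
    (v : EuclideanSpace ℂ (Fin n)) {z : T.Z} (hz : T.s z = α.base) :
    (e.frameMap α).comb v (e.base z) = e.fiber z (α.comb v z) := by
  obtain ⟨k, hk⟩ := α.exists_proj_eq hz
  apply TotalSpace.mk_injective (F := ℂ)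
  refine (mk_comb (e.frameMap α) v (k := k) (by rw [e.vec_frameMap, e.proj_total, hk])).trans ?_
  rw [← e.total_mk, e.vec_frameMap, ← e.total_eq_scale]
  exact congrArg e.total (mk_comb α v hk).symm

/-- The Euclidean norm is at most the sum of the absolute values of the coordinates, and each of
these is bounded by Cauchy–Schwarz. The bound is written as a complex fibre sum so that
`tendsto_fiberSum` applies to it. -/
theorem norm_coeff_le (α : T.Frame) (t : ∀ z, T.L z) :
    ‖α.coeff t‖ ≤ ‖∑ᶠ z ∈ T.s ⁻¹' {α.base}, (‖t z‖ : ℂ)‖ := by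
  have h := finsum_mem_eq_of_bijOn (f := fun k => (‖t (α.vec k).proj‖ : ℂ))
    (g := fun z => (‖t z‖ : ℂ)) _ α.bijOn fun _ _ => rfl
  rw [← h, finsum_mem_univ, finsum_eq_sum_of_fintype, ← Complex.ofReal_sum, Complex.norm_real,
    Real.norm_of_nonneg (Finset.sum_nonneg fun _ _ => norm_nonneg _)]
  have h1 : α.coeff t = ∑ k, EuclideanSpace.single k (α.coeff t k) := by
    ext l
    simp [Pi.single_apply]
  rw [h1]
  refine (norm_sum_le _ _).trans (Finset.sum_le_sum fun k _ => ?_)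
  rw [PiLp.norm_single]
  refine (norm_inner_le_norm _ _).trans ?_
  rw [α.norm_vec, one_mul]

end TwistedCovering.Frame

/-! ### Passing between sections of `P × ℂⁿ` and sections of `L` -/

namespace Correspondence

open PrincipalBundle TwistedCovering

variable {X : Type u} [TopologicalSpace X] {n : ℕ}
  {P : PrincipalBundle.{u, 0, p} (UnitaryNormalizer n) X} {T : TwistedCovering.{u, v, w} X n}
  (θ : Correspondence P T)

theorem frameIsometry_act {x : X} (α : P.carrier) (hα : P.proj α = x) (g : UnitaryNormalizer n)
    (v : EuclideanSpace ℂ (Fin n)) :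
    VecFiber.frameIsometry (α <• g) ((P.proj_act α g).trans hα) v =
      VecFiber.frameIsometry α hα (g • v) :=
  Subtype.ext (Assoc.mk_act α g v)

/-- The element of the fibre of `L` over `z` given by an element `[α, v]` of the fibre of `P × ℂⁿ`
over `s(z)`: it is `θ[α, (k, v_k)]` for the index `k` for which this point lies over `z`. -/
def toLine (z : T.Z) (a : P.VecFiber (T.s z)) : T.L z :=
  (θ.frame (P.surjective_proj (T.s z)).choose).comb
    ((VecFiber.frameIsometry _ (P.surjective_proj (T.s z)).choose_spec).symm a) z

/-- Two points of `P` over `s(z)` differ by some `g`, which moves between frame and vector by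
`comb_act`; so the point chosen in `toLine` does not matter. -/
theorem toLine_frameIsometry (z : T.Z) (α : P.carrier) (hα : P.proj α = T.s z)
    (v : EuclideanSpace ℂ (Fin n)) :
    θ.toLine z (VecFiber.frameIsometry α hα v) = (θ.frame α).comb v z := by
  have key : ∀ (β : P.carrier) (hβ : P.proj β = T.s z), (θ.frame β).comb
      ((VecFiber.frameIsometry β hβ).symm (VecFiber.frameIsometry α hα v)) z =
        (θ.frame α).comb v z := by
    intro β hβ
    obtain ⟨g, rfl⟩ := exists_act (P := P) (hβ.trans hα.symm)
    rw [frameIsometry_act β hβ, LinearIsometryEquiv.symm_apply_apply, θ.frame_act,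
      Frame.comb_act _ _ _ (hβ.symm.trans (θ.base_frame β).symm)]
  exact key _ _

theorem toLine_eq (z : T.Z) (α : P.carrier) (hα : P.proj α = T.s z) (a : P.VecFiber (T.s z)) :
    θ.toLine z a = (θ.frame α).comb ((VecFiber.frameIsometry α hα).symm a) z := by
  rw [← θ.toLine_frameIsometry z α hα, LinearIsometryEquiv.apply_symm_apply]

/-- Meant for sums over a fibre of `s`, where `s(z) = x` is a hypothesis and `ξ (T.s z)` and `ξ x`
have different types. -/
theorem toLine_section (ξ : ∀ x, P.VecFiber x) {z : T.Z} {x : X} {α : P.carrier}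
    (hα : P.proj α = x) (hz : T.s z = x) :
    θ.toLine z (ξ (T.s z)) = (θ.frame α).comb ((VecFiber.frameIsometry α hα).symm (ξ x)) z := by
  subst hz
  exact θ.toLine_eq z α hα _

/-- The element of the fibre of `P × ℂⁿ` over `x` given by a section of `L`. -/
def ofLine (t : ∀ z, T.L z) (x : X) : P.VecFiber x :=
  VecFiber.frameIsometry _ (P.surjective_proj x).choose_spec
    ((θ.frame (P.surjective_proj x).choose).coeff t)

theorem ofLine_eq (t : ∀ z, T.L z) (x : X) (α : P.carrier) (hα : P.proj α = x) :
    θ.ofLine t x = VecFiber.frameIsometry α hα ((θ.frame α).coeff t) := by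
  have key : ∀ (β : P.carrier) (hβ : P.proj β = x),
      VecFiber.frameIsometry β hβ ((θ.frame β).coeff t) =
        VecFiber.frameIsometry α hα ((θ.frame α).coeff t) := by
    intro β hβ
    obtain ⟨g, rfl⟩ := exists_act (P := P) (hα.trans hβ.symm)
    rw [frameIsometry_act α hα, θ.frame_act, Frame.coeff_act]
  exact key _ _

theorem base_frame_of_proj {z : T.Z} {α : P.carrier} (hα : P.proj α = T.s z) :
    T.s z = (θ.frame α).base := hα.symm.trans (θ.base_frame α).symm

theorem toLine_ofLine (t : ∀ z, T.L z) (z : T.Z) : θ.toLine z (θ.ofLine t (T.s z)) = t z := by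
  obtain ⟨α, hα⟩ := P.surjective_proj (T.s z)
  rw [θ.ofLine_eq t _ α hα, θ.toLine_frameIsometry, Frame.comb_coeff _ _ (θ.base_frame_of_proj hα)]

theorem ofLine_toLine (ξ : ∀ x, P.VecFiber x) (x : X) :
    θ.ofLine (fun z => θ.toLine z (ξ (T.s z))) x = ξ x := by
  obtain ⟨α, hα⟩ := P.surjective_proj x
  rw [θ.ofLine_eq _ _ α hα, ← LinearIsometryEquiv.eq_symm_apply]
  refine Frame.coeff_eq _ fun z hz => ?_
  rw [θ.base_frame, hα] at hz
  exact θ.toLine_section ξ hα hz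

/-- The `k`-th vector of a local frame that lies over `z` at `z` lies over `y` for all `y` near `z`.
There the section is the `k`-th coordinate of `ξ` times this vector, and both factors are
continuous. -/
theorem continuous_toLine {ξ : ∀ x, P.VecFiber x}
    (hξ : Continuous fun x => TotalSpace.mk' (EuclideanSpace ℂ (Fin n)) x (ξ x)) :
    Continuous fun z => TotalSpace.mk' ℂ z (θ.toLine z (ξ (T.s z))) := by
  rw [continuous_iff_continuousAt]
  intro z
  set e := P.chartAt (T.s z)
  have he : T.s z ∈ e.triv.baseSet := P.mem_chartAt _
  have hs : ContinuousAt T.s z := T.isCoveringMap.continuous.continuousAt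
  have hev : ∀ᶠ y in 𝓝 z, T.s y ∈ e.triv.baseSet := hs (e.triv.open_baseSet.mem_nhds he)
  obtain ⟨k, hk⟩ := (θ.frame (e.sec (T.s z))).exists_proj_eq
    (θ.base_frame_of_proj (e.proj_sec he))
  have hsec : ContinuousAt (fun y => e.sec (T.s y)) z :=
    (e.continuousOn_sec.continuousAt (e.triv.open_baseSet.mem_nhds he)).comp hs
  have hvec : ContinuousAt (fun y => (θ.frame (e.sec (T.s y))).vec k) z :=
    ((Frame.continuous_vec k).comp θ.continuous_frame).continuousAt.comp hsec
  have hcoord : ContinuousAt (fun y => (e.vecTriv ⟨T.s y, ξ (T.s y)⟩).2 k) z := by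
    have h1 : ContinuousAt (fun x => e.vecTriv ⟨x, ξ x⟩) (T.s z) :=
      ContinuousAt.comp (g := e.vecTriv) (e.vecTriv.continuousAt (e.vecTriv.mem_source.2 he))
        hξ.continuousAt
    have h2 : ContinuousAt (fun y => (e.vecTriv ⟨T.s y, ξ (T.s y)⟩).2) z :=
      continuousAt_snd.comp (h1.comp hs)
    exact (PiLp.continuous_apply 2 _ k).continuousAt.comp h2
  have hproj : ∀ᶠ y in 𝓝 z, ((θ.frame (e.sec (T.s y))).vec k).proj = y := by
    refine T.eventuallyEq_of_lift (z := z) ?_ continuousAt_id ?_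
    · have h := ((FiberBundle.continuous_proj ℂ T.L).continuousAt.comp hvec).tendsto
      simp only [Function.comp_apply, hk] at h
      exact h
    · filter_upwards [hev] with y hy
      rw [Frame.s_proj, θ.base_frame, e.proj_sec hy]
  refine (continuous_scale.continuousAt.comp (hcoord.prodMk hvec)).congr ?_
  filter_upwards [hev, hproj] with y hy hky
  rw [θ.toLine_eq y _ (e.proj_sec hy), Frame.mk_comb _ _ hky, Function.comp_apply,
    e.vecTriv_apply hy]

/-- The coordinates of `t` are pairings with the vectors of a frame, hence continuous in the frame;
a local section of `P` supplies the frames. -/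
theorem continuous_ofLine {t : ∀ z, T.L z} (ht : Continuous fun z => TotalSpace.mk' ℂ z (t z)) :
    Continuous fun x => TotalSpace.mk' (EuclideanSpace ℂ (Fin n)) x (θ.ofLine t x) := by
  rw [VecFiber.isInducing_toAssoc.continuous_iff, continuous_iff_continuousAt]
  intro x
  set e := P.chartAt x
  have he : x ∈ e.triv.baseSet := P.mem_chartAt _
  have hsec : ContinuousAt e.sec x :=
    e.continuousOn_sec.continuousAt (e.triv.open_baseSet.mem_nhds he)
  have hcoeff : Continuous fun α : T.Frame => α.coeff t := by
    refine (PiLp.continuous_toLp 2 _).comp (continuous_pi fun k => ?_)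
    have h : Continuous fun α : T.Frame =>
        pair (α.vec k) (TotalSpace.mk' ℂ (α.vec k).proj (t (α.vec k).proj)) :=
      continuousOn_pair_of_proj_eq.comp_continuous ((Frame.continuous_vec k).prodMk
        (ht.comp ((FiberBundle.continuous_proj ℂ T.L).comp (Frame.continuous_vec k))))
        fun _ => rfl
    exact h.congr fun α => pair_mk _ _ _
  have h : ContinuousAt (fun y => (Assoc.mk (e.sec y) ((θ.frame (e.sec y)).coeff t) :
      P.Assoc (EuclideanSpace ℂ (Fin n)))) x :=
    ContinuousAt.comp (f := fun y => (e.sec y, (θ.frame (e.sec y)).coeff t))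
      Assoc.continuous_mk.continuousAt
      (hsec.prodMk ((hcoeff.comp θ.continuous_frame).continuousAt.comp hsec))
  refine h.congr ?_
  filter_upwards [e.triv.open_baseSet.mem_nhds he] with y hy
  change _ = (θ.ofLine t y).1
  rw [θ.ofLine_eq t y _ (e.proj_sec hy), VecFiber.frameIsometry_apply]

/-- The map `Γ₀(P × ℂⁿ) → Γ₀(Z, s, L)`. -/
def mapSections (ξ : C0Sections (EuclideanSpace ℂ (Fin n)) P.VecFiber) : T.Sections :=
  (⟨fun z => θ.toLine z (ξ (T.s z)), θ.continuous_toLine ξ.2.1, by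
    -- The value at `z` is bounded by the norm of `ξ` at `s(z)`, and `s` is proper.
    refine squeeze_zero (fun _ => norm_nonneg _) (fun z => ?_)
      (ξ.2.2.comp T.tendsto_s_cocompact)
    obtain ⟨α, hα⟩ := P.surjective_proj (T.s z)
    refine (congrArg norm (θ.toLine_eq z α hα _)).trans_le ?_
    exact (Frame.norm_comb_le _ _ (θ.base_frame_of_proj hα)).trans_eq
      (LinearIsometryEquiv.norm_map _ _)⟩ : C0Sections ℂ T.L)

theorem mapSections_apply (ξ : C0Sections (EuclideanSpace ℂ (Fin n)) P.VecFiber) (z : T.Z) :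
    θ.mapSections ξ z = θ.toLine z (ξ (T.s z)) := rfl

/-- The map `Γ₀(Z, s, L) → Γ₀(P × ℂⁿ)`. -/
def invSections (t : T.Sections) : C0Sections (EuclideanSpace ℂ (Fin n)) P.VecFiber :=
  ⟨fun x => θ.ofLine t x, θ.continuous_ofLine t.toC0Sections.2.1, by
    have h : Tendsto (fun z => (‖t z‖ : ℂ)) (cocompact T.Z) (𝓝 0) := by
      rw [tendsto_zero_iff_norm_tendsto_zero]
      simpa using t.toC0Sections.2.2
    refine squeeze_zero (fun _ => norm_nonneg _) (fun x => ?_)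
      (tendsto_zero_iff_norm_tendsto_zero.1 (T.tendsto_fiberSum h))
    obtain ⟨α, hα⟩ := P.surjective_proj x
    refine ((congrArg norm (θ.ofLine_eq t x α hα)).trans
      (LinearIsometryEquiv.norm_map _ _)).trans_le ?_
    rw [← hα, ← θ.base_frame]
    exact (θ.frame α).norm_coeff_le t⟩

/-- The isomorphism of right Hilbert `C₀(X)`-modules `Γ₀(P × ℂⁿ) ≅ Γ₀(Z, s, L)` for a principal bundle
`P` that corresponds to `(Z, s, L)`. -/
def sectionsIso : HilbertModuleIso C₀(X, ℂ)
    (C0Sections (EuclideanSpace ℂ (Fin n)) P.VecFiber) T.Sections where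
  toFun := θ.mapSections
  invFun := θ.invSections
  left_inv ξ := C0Sections.ext fun x => θ.ofLine_toLine ξ x
  right_inv t := C0Sections.ext fun z => θ.toLine_ofLine t z
  map_add' ξ η := C0Sections.ext fun z => by
    change θ.toLine z (ξ (T.s z) + η (T.s z)) = θ.toLine z (ξ (T.s z)) + θ.toLine z (η (T.s z))
    obtain ⟨α, hα⟩ := P.surjective_proj (T.s z)
    simp only [θ.toLine_eq z α hα, map_add, Frame.comb_add _ _ _ (θ.base_frame_of_proj hα)]
  map_smul' c ξ := C0Sections.ext fun z => by
    change θ.toLine z (c • ξ (T.s z)) = c • θ.toLine z (ξ (T.s z))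
    obtain ⟨α, hα⟩ := P.surjective_proj (T.s z)
    simp only [θ.toLine_eq z α hα, map_smul, Frame.comb_smul _ _ _ (θ.base_frame_of_proj hα)]
  map_act g ξ := C0Sections.ext fun z => by
    change θ.toLine z (g (T.s z) • ξ (T.s z)) = g (T.s z) • θ.toLine z (ξ (T.s z))
    obtain ⟨α, hα⟩ := P.surjective_proj (T.s z)
    simp only [θ.toLine_eq z α hα, map_smul, Frame.comb_smul _ _ _ (θ.base_frame_of_proj hα)]
  inner_map ξ η := by
    ext x
    change Sections.innerC0 (θ.mapSections ξ) (θ.mapSections η) x = inner ℂ (ξ x) (η x)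
    rw [Sections.innerC0_apply]
    obtain ⟨α, rfl⟩ := P.surjective_proj x
    -- Both inner products are expressed through the coordinates of `ξ` and `η` in the frame given
    -- by one `α`.
    rw [← (VecFiber.frameIsometry α rfl).symm.inner_map_map, ← Frame.finsum_inner_comb (θ.frame α),
      θ.base_frame]
    refine finsum_mem_congr rfl fun z hz => ?_
    rw [mapSections_apply, mapSections_apply, θ.toLine_section ξ.1 rfl hz,
      θ.toLine_section η.1 rfl hz]

variable {P' : PrincipalBundle.{u, 0, p} (UnitaryNormalizer n) X}
  {T' : TwistedCovering.{u, v, w} X n} (θ' : Correspondence P' T')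

/-- If `ξ` is `[α, v]` over `s(z)`, its image under `f` is `[f(α), v]` with the same `v`, and the
frame of `f(α)` is the image under `e` of the frame of `α`; so `comb_frameMap` compares the two
sides. -/
theorem sectionsIso_natural (e : T.Iso T') (ξ : C0Sections (EuclideanSpace ℂ (Fin n)) P.VecFiber) :
    e.sectionsIso.toLinearEquiv (θ.sectionsIso.toLinearEquiv ξ) =
      θ'.sectionsIso.toLinearEquiv ((inducedIso θ θ' e).sectionsIso.toLinearEquiv ξ) := by
  refine e.sections_ext fun z => ?_
  obtain ⟨α, hα⟩ := P.surjective_proj (T.s z)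
  obtain ⟨v, hv⟩ := (VecFiber.frameIsometry α hα).surjective (ξ (T.s z))
  set f := inducedIso θ θ' e
  have h1 : θ.mapSections ξ z = (θ.frame α).comb v z := by
    rw [mapSections_apply, ← hv, toLine_frameIsometry]
  have h2 : θ'.mapSections (f.mapSections ξ) (e.base z) =
      (θ'.frame (f.toHomeomorph α)).comb v (e.base z) := by
    have h3 : f.mapSections ξ (T.s z) = VecFiber.frameIsometry (f.toHomeomorph α)
        ((f.proj_map α).trans hα) v := by
      rw [PrincipalBundle.Iso.mapSections_apply, ← hv, PrincipalBundle.Iso.vecMap_frame]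
    rw [mapSections_apply, θ'.toLine_section (f.mapSections ξ).1 ((f.proj_map α).trans hα)
      (e.s_base z)]
    refine congrArg (fun w => (θ'.frame (f.toHomeomorph α)).comb w (e.base z)) ?_
    rw [LinearIsometryEquiv.symm_apply_eq]
    exact h3
  refine (e.mapSections_apply _ z).trans (Eq.trans ?_ h2.symm)
  rw [frame_inducedIso, Frame.comb_frameMap _ _ _ (θ.base_frame_of_proj hα)]
  exact congrArg (e.fiber z) h1

end Correspondence

end TwistedCoverings

end

open TwistedCoverings ZeroAtInfty
theorem mainTheorem2 (X : Type u) [TopologicalSpace X] [T2Space X] [LocallyCompactSpace X]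
    (n : ℕ) :
    (∀ T : TwistedCovering.{u, v, w} X n,
      ∃ P : PrincipalBundle.{u, 0, max v w} (UnitaryNormalizer n) X,
        Nonempty (Correspondence P T)) ∧
    ∃ Φ : ∀ (T : TwistedCovering.{u, v, w} X n)
        (P : PrincipalBundle.{u, 0, p} (UnitaryNormalizer n) X), Correspondence P T →
        HilbertModuleIso C₀(X, ℂ) (C0Sections (EuclideanSpace ℂ (Fin n)) P.VecFiber) T.Sections,
      ∀ (T T' : TwistedCovering.{u, v, w} X n) (e : T.Iso T')
        (P P' : PrincipalBundle.{u, 0, p} (UnitaryNormalizer n) X)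
        (θ : Correspondence P T) (θ' : Correspondence P' T'),
        ∃ f : P.Iso P', IsInducedBy f θ θ' e ∧ (∀ f' : P.Iso P', IsInducedBy f' θ θ' e → f' = f) ∧
          ∀ ξ : C0Sections (EuclideanSpace ℂ (Fin n)) P.VecFiber,
            e.sectionsIso.toLinearEquiv ((Φ T P θ).toLinearEquiv ξ) =
              (Φ T' P' θ').toLinearEquiv (f.sectionsIso.toLinearEquiv ξ) :=
  ⟨fun T => ⟨T.frameBundle, T.nonempty_correspondence_frameBundle⟩,
    fun _ _ θ => θ.sectionsIso, fun _ _ e _ _ θ θ' => ⟨Correspondence.inducedIso θ θ' e,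
      (Correspondence.isInducedBy_iff θ θ' e _).2 (Correspondence.frame_inducedIso θ θ' e),
      fun _ => Correspondence.eq_inducedIso θ θ' e, Correspondence.sectionsIso_natural θ θ' e⟩⟩
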